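/- **Setting.** On a probability space $(\Omega,\mathscr F,\mathbb P)$ consider, for $i=1,\dots,N$, the regressions $$y_{i,t}=\alpha_i+x_{i,t}'\beta_i+u_{i,t},\qquad t=1,2,\dots,$$ with $x_{i,t}\in\mathbb R^{k_i}$, $k=\sum_i k_i$, $u_t=(u_{1,t},\dots,u_{N,t})'$, $x_t=(x_{1,t}',\dots,x_{N,t}')'$, where the processes $x_t,u_t$ are indexed by $t\in\mathbb Z$, $\mathbb E[u_t]=0$ and $\mathbb E[x_t]=\mu_x$ for all $t$. Let $X_t\in\mathbb R^{k\times N}$ be the block-diagonal matrix with diagonal blocks $x_{1,t},\dots,x_{N,t}$, let $Z_t'=[I_N,\ X_t']$ and $\kappa=(\alpha',\beta')'$, so that $y_t=Z_t'\kappa+u_t$, and let $$\widehat\kappa^{OLS}_T=\Big(\sum_{t=1}^T Z_tZ_t'\Big)^{-1}\Big(\sum_{t=1}^T Z_ty_t\Big).$$ Put $\bar z_t=((x_t-\mu_x)',u_t')'\in\mathbb R^m$, $m=k+N$. Let $\mathscr H_t\subseteq L^2(\Omega;\mathbb R^m)$ be the closed linear span, with matrix coefficients, of $\bar z_t,\bar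 z_{t-1},\dots$, let $\mathscr P_{t-1}$ be the orthogonal projection onto $\mathscr H_{t-1}$, and let $\varepsilon_t=\bar z_t-\mathscr P_{t-1}[\bar z_t]$. **Assumption 1.** (A1.1) $\{\bar z_t\}$ is covariance-stationary with finite second moments and purely nondeterministic ($\bigcap_t\mathscr H_t=\{0\}$), and for some finite $p_0\ge1$ and all $t$, $\mathscr P_{t-1}[\bar z_t]$ equals the orthogonal projection of $\bar z_t$ onto the span (with matrix coefficients) of $\bar z_{t-1},\dots,\bar z_{t-p_0}$. (A1.2) For some $\delta>0$, $\{\varepsilon_t\}$ is strongly mixing with coefficients $$\alpha_\varepsilon(\ell)=\sup_t\ \sup\{|\mathbb P(A\cap B)-\mathbb P(A)\mathbb P(B)|:\ A\in\sigma(\varepsilon_s,s\le t),\ B\in\sigma(\varepsilon_s,s\ge t+\ell)\}$$ satisfying $\sum_{\ell\ge1}\alpha_\varepsilon(\ell)^{\delta/(2+\delta)}<\infty$; moreover $\sup_t\mathbb E\|\varepsilon_t\|^{4+2\delta}<\infty$, and $\Sigma=\mathbb E[\varepsilon_t\varepsilon_t']$ is positive definite. **Assumption 2.** $Q_Z:=\mathbb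 E[Z_tZ_t']$ is positive definite. **Proposition 3.** Under Assumptions 1 and 2, the OLS estimator $\widehat\kappa^{OLS}_T$ is consistent for $\kappa$ (that is, $\widehat\kappa^{OLS}_T\to\kappa$ in probability as $T\to\infty$) if and only if $\mathbb E[Z_tu_t]=0$; equivalently, if and only if the contemporaneous orthogonality condition $\mathbb E[X_tu_t]=0$ holds. In general, as $T\to\infty$, $$\widehat\kappa^{OLS}_T\ \xrightarrow{\ p\ }\ \kappa+Q_Z^{-1}\begin{pmatrix}0\\ \mathbb E[X_tu_t]\end{pmatrix}.$$ (The expectations $\mathbb E[Z_tZ_t']$, $\mathbb E[Z_tu_t]$, $\mathbb E[X_tu_t]$ do not depend on $t$.) -/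

import Mathlib

open MeasureTheory ProbabilityTheory Filter Topology
open scoped ENNReal NNReal Matrix

noncomputable section

namespace SUR

/- ### Second-order theory of a vector process indexed by the integers -/

section SecondOrder

variable {Ω : Type*} [MeasurableSpace Ω] {ι : Type*} [Fintype ι]

/-- Finite second moments, constant mean, and autocovariances `Cov(z_s, z_{s-ℓ})` that depend on
the lag `ℓ` only. -/
structure IsCovStationary (P : Measure Ω) (z : ℤ → Ω → EuclideanSpace ℝ ι) : Prop where
  memLp : ∀ t, MemLp (z t) 2 P
  mean_eq : ∀ s t, ∫ ω, z s ω ∂P = ∫ ω, z t ω ∂P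
  cov_eq : ∀ (ℓ s t : ℤ) (a b : ι),
    cov[fun ω => z s ω a, fun ω => z (s - ℓ) ω b; P]
      = cov[fun ω => z t ω a, fun ω => z (t - ℓ) ω b; P]

/-- The closed linear subspace of `L²(Ω; ℝ^ι)` generated by the vectors `z_s`, `s ∈ S`. As usual
for vector processes the linear combinations have matrix coefficients: the generators are the
random vectors `A z_s`, `A` a (constant) linear map. For finite `S` the span is finite-dimensional,
so that taking the closure changes nothing. -/
def closedSpan (P : Measure Ω) (z : ℤ → Ω → EuclideanSpace ℝ ι) (S : Set ℤ) :
    Submodule ℝ (Lp (EuclideanSpace ℝ ι) 2 P) :=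
  (Submodule.span ℝ {V : Lp (EuclideanSpace ℝ ι) 2 P |
    ∃ s ∈ S, ∃ A : EuclideanSpace ℝ ι →L[ℝ] EuclideanSpace ℝ ι,
      V =ᵐ[P] fun ω => A (z s ω)}).topologicalClosure

instance (P : Measure Ω) (z : ℤ → Ω → EuclideanSpace ℝ ι) (S : Set ℤ) :
    (closedSpan P z S).HasOrthogonalProjection :=
  inferInstanceAs (Submodule.topologicalClosure _).HasOrthogonalProjection

/-- `𝓗_t`, generated by the present and the past of the process. -/
def pastSpace (P : Measure Ω) (z : ℤ → Ω → EuclideanSpace ℝ ι) (t : ℤ) :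
    Submodule ℝ (Lp (EuclideanSpace ℝ ι) 2 P) :=
  closedSpan P z (Set.Iic t)

instance (P : Measure Ω) (z : ℤ → Ω → EuclideanSpace ℝ ι) (t : ℤ) :
    (pastSpace P z t).HasOrthogonalProjection :=
  inferInstanceAs (closedSpan P z _).HasOrthogonalProjection

/-- `𝓗_{t-1}^{(p)}`, generated by the last `p` values `z_{t-1}, …, z_{t-p}` before `t`. -/
def lagSpace (P : Measure Ω) (z : ℤ → Ω → EuclideanSpace ℝ ι) (p : ℕ) (t : ℤ) :
    Submodule ℝ (Lp (EuclideanSpace ℝ ι) 2 P) :=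
  closedSpan P z (Set.Icc (t - p) (t - 1))

instance (P : Measure Ω) (z : ℤ → Ω → EuclideanSpace ℝ ι) (p : ℕ) (t : ℤ) :
    (lagSpace P z p t).HasOrthogonalProjection :=
  inferInstanceAs (closedSpan P z _).HasOrthogonalProjection

/-- The one-step-ahead innovation `ε_t = z_t - 𝓟_{t-1}[z_t]`. -/
def innovation (P : Measure Ω) (z : ℤ → Ω → EuclideanSpace ℝ ι) (hz : ∀ t, MemLp (z t) 2 P)
    (t : ℤ) : Lp (EuclideanSpace ℝ ι) 2 P :=
  (hz t).toLp (z t) - (pastSpace P z (t - 1)).starProjection ((hz t).toLp (z t))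

/-- The process is purely nondeterministic: its remote past is trivial. -/
def IsPurelyNondeterministic (P : Measure Ω) (z : ℤ → Ω → EuclideanSpace ℝ ι) : Prop :=
  ⨅ t : ℤ, pastSpace P z t = ⊥

/-- The strong mixing coefficient
`α(ℓ) = sup_t sup { |P(A ∩ B) - P(A) P(B)| : A ∈ σ(e_s, s ≤ t), B ∈ σ(e_s, s ≥ t + ℓ) }`. -/
def mixingCoeff {E : Type*} [MeasurableSpace E] (P : Measure Ω) (e : ℤ → Ω → E) (ℓ : ℕ) : ℝ :=
  sSup {r : ℝ | ∃ (t : ℤ) (A B : Set Ω),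
    MeasurableSet[⨆ s : Set.Iic t, MeasurableSpace.comap (e s) inferInstance] A ∧
    MeasurableSet[⨆ s : Set.Ici (t + (ℓ : ℤ)), MeasurableSpace.comap (e s) inferInstance] B ∧
    r = |P.real (A ∩ B) - P.real A * P.real B|}

/-- The second-moment matrix `E[e e']` of a random vector. -/
def secondMoment (P : Measure Ω) (e : Ω → EuclideanSpace ℝ ι) : Matrix ι ι ℝ :=
  Matrix.of fun a b => ∫ ω, e ω a * e ω b ∂P

/-- Finite-predictor exactness at some finite lag, together with the mixing, moment and
nondegeneracy conditions on the innovations. -/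
structure FinitePredictorExactness (P : Measure Ω) (z : ℤ → Ω → EuclideanSpace ℝ ι) : Prop where
  stationary : IsCovStationary P z
  nondeterministic : IsPurelyNondeterministic P z
  exactness : ∃ p₀ : ℕ, 1 ≤ p₀ ∧ ∀ t : ℤ,
    (pastSpace P z (t - 1)).starProjection ((stationary.memLp t).toLp (z t))
      = (lagSpace P z p₀ t).starProjection ((stationary.memLp t).toLp (z t))
  mixing_moments : ∃ δ : ℝ, 0 < δ ∧
    Tendsto (mixingCoeff P fun t => ⇑(innovation P z stationary.memLp t)) atTop (𝓝 0) ∧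
    Summable (fun ℓ : ℕ =>
      mixingCoeff P (fun t => ⇑(innovation P z stationary.memLp t)) (ℓ + 1) ^ (δ / (2 + δ))) ∧
    ∃ C : ℝ≥0, ∀ t : ℤ,
      ∫⁻ ω, ‖innovation P z stationary.memLp t ω‖ₑ ^ (4 + 2 * δ) ∂P ≤ C
  posDef : ∀ t : ℤ, (secondMoment P (innovation P z stationary.memLp t)).PosDef

end SecondOrder

/- ### The regression system

There are `N` equations; equation `i` has the `k i` regressors `x i t ω 0, x i t ω 1, …`.
The stacked regressors are indexed by pairs `⟨i, j⟩` and the stacked coefficients `(α', β')'` by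
`Fin N ⊕ (Σ i, Fin (k i))`. -/

section Regression

variable {Ω : Type*} [MeasurableSpace Ω] {N : ℕ} {k : Fin N → ℕ}

/-- The centered joint vector `((x_t - μ_x)', u_t')'`. -/
def zbar (x : (i : Fin N) → ℤ → Ω → Fin (k i) → ℝ) (u : ℤ → Ω → Fin N → ℝ)
    (μx : (i : Fin N) → Fin (k i) → ℝ) (t : ℤ) (ω : Ω) :
    EuclideanSpace ℝ ((Σ i, Fin (k i)) ⊕ Fin N) :=
  WithLp.toLp 2 (Sum.elim (fun p => x p.1 t ω p.2 - μx p.1 p.2) (u t ω))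

/-- The block-diagonal regressor matrix `X_t`, of size `k × N`. -/
def X (x : (i : Fin N) → ℤ → Ω → Fin (k i) → ℝ) (t : ℤ) (ω : Ω) :
    Matrix (Σ i, Fin (k i)) (Fin N) ℝ :=
  Matrix.of fun p i => if p.1 = i then x p.1 t ω p.2 else 0

/-- `Z_t`, of size `(N + k) × N`, with `Z_t' = [I_N, X_t']`. -/
def Z (x : (i : Fin N) → ℤ → Ω → Fin (k i) → ℝ) (t : ℤ) (ω : Ω) :
    Matrix (Fin N ⊕ (Σ i, Fin (k i))) (Fin N) ℝ :=
  Matrix.fromRows 1 (X x t ω)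

/-- `κ = (α', β')'`. -/
def kappa (α : Fin N → ℝ) (β : (i : Fin N) → Fin (k i) → ℝ) : Fin N ⊕ (Σ i, Fin (k i)) → ℝ :=
  Sum.elim α fun p => β p.1 p.2

/-- The system OLS estimator from the observations `t = 1, …, T`. (Where the matrix is singular,
the inverse is `0` by convention.) -/
def ols (x : (i : Fin N) → ℤ → Ω → Fin (k i) → ℝ) (y : ℤ → Ω → Fin N → ℝ) (T : ℕ) (ω : Ω) :
    Fin N ⊕ (Σ i, Fin (k i)) → ℝ :=
  (∑ t ∈ Finset.Icc 1 T, Z x (t : ℤ) ω * (Z x (t : ℤ) ω)ᵀ)⁻¹ *ᵥ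
    (∑ t ∈ Finset.Icc 1 T, Z x (t : ℤ) ω *ᵥ y (t : ℤ) ω)

/-- `Q_Z = E[Z_t Z_t']`. -/
def QZ (P : Measure Ω) (x : (i : Fin N) → ℤ → Ω → Fin (k i) → ℝ) (t : ℤ) :
    Matrix (Fin N ⊕ (Σ i, Fin (k i))) (Fin N ⊕ (Σ i, Fin (k i))) ℝ :=
  Matrix.of fun a b => ∫ ω, (Z x t ω * (Z x t ω)ᵀ) a b ∂P

/-- `E[Z_t u_t]`. -/
def EZu (P : Measure Ω) (x : (i : Fin N) → ℤ → Ω → Fin (k i) → ℝ) (u : ℤ → Ω → Fin N → ℝ)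
    (t : ℤ) : Fin N ⊕ (Σ i, Fin (k i)) → ℝ :=
  fun a => ∫ ω, (Z x t ω *ᵥ u t ω) a ∂P

/-- `E[X_t u_t]`. -/
def EXu (P : Measure Ω) (x : (i : Fin N) → ℤ → Ω → Fin (k i) → ℝ) (u : ℤ → Ω → Fin N → ℝ)
    (t : ℤ) : (Σ i, Fin (k i)) → ℝ :=
  fun p => ∫ ω, (X x t ω *ᵥ u t ω) p ∂P

/-- The estimator sequence converges in probability to the constant `θ`; (weak) consistency
for `θ`. -/
def ConvergesInProbTo {ι : Type*} [Fintype ι] (P : Measure Ω) (est : ℕ → Ω → ι → ℝ)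
    (θ : ι → ℝ) : Prop :=
  TendstoInMeasure P est atTop fun _ => θ

end Regression

end SUR

end

/-! For `T ≥ 1` the estimator is a fixed function of the sample averages of the entries of `Z_t
Z_t'` and `Z_t u_t` (`ols_eq_lsMap`), and this function is continuous wherever the averaged matrix
is invertible, in particular at `Q_Z`. A weak law of large numbers for these averages therefore
gives the probability limit, `κ + Q_Z⁻¹ E[Z_t u_t]`. The first block of `E[Z_t u_t]` is `E[u_t] =
0`. Uniqueness of limits in probability and invertibility of `Q_Z` turn consistency into `E[Z_t u_t]
= 0`.

The law of large numbers must pass from the innovations, which mix, to products of coordinates of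
`zbar`, which are only linear functionals of the innovations' infinite past. The bridge is
`IsApprox`: approximation in `L^p`, uniformly in `t`, by bounded functions of finitely many recent
innovations. For such functions the covariance inequality bounds autocovariances by mixing
coefficients, so the variance of the average is dominated by a Cesàro mean of a null sequence.

The coordinates of `zbar` are `L²`-approximable by a truncated Wold decomposition
(`exists_innovation_filter_near`). The finite predictor is a finite filter whose coefficients do not
depend on `t`; iterating it expresses `z_t` by finitely many innovations plus a remainder, the
projection of `z_t` onto the remote past. Pure nondeterminism makes the remainder small at time `0`,
and stationarity makes its norm the same at every time. The innovations themselves are approximated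
by truncation, using their moment bound. Products of `L²`-approximable processes are
`L¹`-approximable (`IsApprox.mul`), which suffices for the law of large numbers. -/

noncomputable section

namespace SUR

/-! ### Covariance inequality for bounded variables under strong mixing. -/

section Mixing

variable {Ω : Type*} {m₁ m₂ : MeasurableSpace Ω} [mΩ : MeasurableSpace Ω] {P : Measure Ω}
  [IsProbabilityMeasure P]

/-- The covariance of a bounded `m₁`-measurable variable with `Y` is controlled by the covariance of
the indicator of some `m₁`-measurable event with `Y`. -/
theorem exists_abs_cov_le (hm : m₁ ≤ mΩ) {X Y : Ω → ℝ} {M : ℝ}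
    (hX : Measurable[m₁] X) (hXM : ∀ ω, |X ω| ≤ M) (hY : Integrable Y P) :
    ∃ A, MeasurableSet[m₁] A ∧ |cov[X, Y; P]| ≤ 2 * M * |cov[A.indicator 1, Y; P]| := by
  set G : Ω → ℝ := fun ω => Y ω - ∫ ω, Y ω ∂P with hG
  have hGi : Integrable G P := hY.sub (integrable_const _)
  have hG0 : ∫ ω, G ω ∂P = 0 := by
    rw [hG, integral_sub hY (integrable_const _)]; simp
  have cov_eq : ∀ V : Ω → ℝ, Measurable[mΩ] V → (∃ C, ∀ ω, |V ω| ≤ C) →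
      cov[V, Y; P] = ∫ ω, V ω * G ω ∂P := by
    rintro V hV ⟨C, hC⟩
    have h1 : Integrable (fun ω => V ω * G ω) P :=
      hGi.bdd_mul hV.aestronglyMeasurable (ae_of_all _ fun ω => by simpa using hC ω)
    have : cov[V, Y; P] = ∫ ω, (V ω * G ω - (∫ ω, V ω ∂P) * G ω) ∂P := by
      rw [covariance]; congr 1; ext ω; simp only [hG]; ring
    rw [this, integral_sub h1 (hGi.const_mul _), integral_const_mul, hG0]; simp
  -- `X` sees `Y` only through `g`: the covariance is `E[X g]`, at most `M E|g|`. The extremal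
  -- choice of `X` is the sign of `g`, hence the event `0 ≤ g`.
  set g := P[G | m₁] with hg
  have hgm : StronglyMeasurable[m₁] g := stronglyMeasurable_condExp
  have hgi : Integrable g P := integrable_condExp
  refine ⟨{ω | 0 ≤ g ω}, measurableSet_le measurable_const hgm.measurable, ?_⟩
  set A := {ω | 0 ≤ g ω} with hA
  have hAm : MeasurableSet[m₁] A := measurableSet_le measurable_const hgm.measurable
  have hg0 : ∫ ω, g ω ∂P = 0 := by rw [hg, integral_condExp hm, hG0]
  have hM : 0 ≤ M := by
    obtain ⟨ω⟩ : Nonempty Ω := P.nonempty_of_neZero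
    exact (abs_nonneg _).trans (hXM ω)
  have e1 : cov[X, Y; P] = ∫ ω, X ω * g ω ∂P := by
    rw [cov_eq X (hX.mono hm le_rfl) ⟨M, hXM⟩, ← integral_condExp hm]
    refine integral_congr_ae ?_
    exact condExp_stronglyMeasurable_mul_of_bound hm hX.stronglyMeasurable hGi M
      (ae_of_all _ fun ω => by simpa using hXM ω)
  have e2 : cov[A.indicator 1, Y; P] = ∫ ω in A, g ω ∂P := by
    rw [cov_eq _ (measurable_one.indicator (hm _ hAm)) ⟨1, fun ω => by
      by_cases h : ω ∈ A <;> simp [h]⟩, hg, setIntegral_condExp hm hGi hAm,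
      ← integral_indicator (hm _ hAm)]
    congr 1; ext ω; by_cases h : ω ∈ A <;> simp [h]
  -- `g` has mean zero, so its positive and negative parts have equal integrals.
  have e3 : ∫ ω, |g ω| ∂P = 2 * ∫ ω in A, g ω ∂P := by
    rw [← integral_indicator (hm _ hAm), ← integral_const_mul,
      ← sub_zero (∫ ω, 2 * A.indicator g ω ∂P), ← hg0,
      ← integral_sub ((hgi.indicator (hm _ hAm)).const_mul 2) hgi]
    congr 1; ext ω
    by_cases h : ω ∈ A
    · have : 0 ≤ g ω := h
      simp [h, abs_of_nonneg this]; ring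
    · have : g ω < 0 := not_le.mp h
      simp [h, abs_of_neg this]
  calc |cov[X, Y; P]| ≤ ∫ ω, |X ω * g ω| ∂P := by rw [e1]; exact abs_integral_le_integral_abs
    _ ≤ ∫ ω, M * |g ω| ∂P := by
        refine integral_mono_of_nonneg (ae_of_all _ fun ω => abs_nonneg _) (hgi.abs.const_mul M)
          (ae_of_all _ fun ω => ?_)
        simp only [abs_mul]
        exact mul_le_mul_of_nonneg_right (hXM ω) (abs_nonneg _)
    _ = 2 * M * ∫ ω in A, g ω ∂P := by rw [integral_const_mul, e3]; ring
    _ ≤ 2 * M * |cov[A.indicator 1, Y; P]| := by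
        rw [e2]; exact mul_le_mul_of_nonneg_left (le_abs_self _) (by positivity)

theorem cov_indicator_indicator {A B : Set Ω} (hA : MeasurableSet A) (hB : MeasurableSet B) :
    cov[A.indicator 1, B.indicator 1; P] = P.real (A ∩ B) - P.real A * P.real B := by
  have hL : ∀ {S : Set Ω}, MeasurableSet S → MemLp (S.indicator (1 : Ω → ℝ)) 2 P := fun h =>
    (memLp_const (1 : ℝ)).indicator h
  rw [covariance_eq_sub (hL hA) (hL hB), integral_indicator_one hA, integral_indicator_one hB,
    ← integral_indicator_one (hA.inter hB)]
  congr 2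
  rw [Set.inter_indicator_one]

/-- The covariance inequality for bounded variables. -/
theorem abs_cov_le_of_bounded (h₁ : m₁ ≤ mΩ) (h₂ : m₂ ≤ mΩ)
    {X Y : Ω → ℝ} {M a : ℝ} (hX : Measurable[m₁] X) (hY : Measurable[m₂] Y)
    (hXM : ∀ ω, |X ω| ≤ M) (hYM : ∀ ω, |Y ω| ≤ M)
    (ha : ∀ A B, MeasurableSet[m₁] A → MeasurableSet[m₂] B →
      |P.real (A ∩ B) - P.real A * P.real B| ≤ a) :
    |cov[X, Y; P]| ≤ 4 * M ^ 2 * a := by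
  have hM : 0 ≤ M := by
    obtain ⟨ω⟩ : Nonempty Ω := P.nonempty_of_neZero
    exact (abs_nonneg _).trans (hXM ω)
  have hYi : Integrable Y P := Integrable.of_bound (hY.mono h₂ le_rfl).aestronglyMeasurable M
    (ae_of_all _ fun ω => by simpa using hYM ω)
  -- Each variable in turn is replaced by the indicator of an event, at the cost of a factor `2 * M`
  -- each time.
  obtain ⟨A, hA, hXA⟩ := exists_abs_cov_le h₁ hX hXM hYi
  have hA' : Integrable (A.indicator (1 : Ω → ℝ)) P :=
    (integrable_const (1 : ℝ)).indicator (h₁ _ hA)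
  obtain ⟨B, hB, hYB⟩ := exists_abs_cov_le (P := P) h₂ hY hYM
    hA'
  rw [covariance_comm Y, covariance_comm (B.indicator 1),
    cov_indicator_indicator (h₁ _ hA) (h₂ _ hB)] at hYB
  calc _ ≤ 2 * M * |cov[A.indicator 1, Y; P]| := hXA
    _ ≤ 2 * M * (2 * M * a) := by
        gcongr; exact hYB.trans (by gcongr; exact ha A B hA hB)
    _ = _ := by ring

theorem abs_cov_le_of_abs_le {X Y : Ω → ℝ} {M : ℝ} (hXM : ∀ ω, |X ω| ≤ M)
    (hYM : ∀ ω, |Y ω| ≤ M) : |cov[X, Y; P]| ≤ 4 * M ^ 2 := by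
  have key : ∀ V : Ω → ℝ, (∀ ω, |V ω| ≤ M) → ∀ ω, |V ω - ∫ ω, V ω ∂P| ≤ 2 * M := by
    intro V hV ω
    have h1 : |∫ ω, V ω ∂P| ≤ M := by
      have := norm_integral_le_of_norm_le_const (μ := P) (f := V) (C := M)
        (ae_of_all _ fun ω => by simpa using hV ω)
      simpa using this
    have := abs_sub (V ω) (∫ ω, V ω ∂P)
    linarith [hV ω]
  rw [covariance]
  have := norm_integral_le_of_norm_le_const (μ := P) (C := 4 * M ^ 2)
    (f := fun ω => (X ω - ∫ ω, X ω ∂P) * (Y ω - ∫ ω, Y ω ∂P)) (ae_of_all _ fun ω => by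
      rw [Real.norm_eq_abs, abs_mul]
      have := mul_le_mul (key X hXM ω) (key Y hYM ω) (abs_nonneg _)
        ((abs_nonneg _).trans (key X hXM ω))
      linarith)
  simpa using this

end Mixing

/-! ### Law of large numbers for bounded processes with finite memory. -/

section Memory

variable {Ω : Type*}

/-- The `σ`-algebra generated by `e_s`, `s ∈ S`. -/
@[reducible] def sigmaOn {E : Type*} [MeasurableSpace E] (e : ℤ → Ω → E) (S : Set ℤ) :
    MeasurableSpace Ω :=
  ⨆ s : S, MeasurableSpace.comap (e s) inferInstance

variable {E : Type*} [MeasurableSpace E] {e : ℤ → Ω → E}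

theorem sigmaOn_mono {S S' : Set ℤ} (h : S ⊆ S') : sigmaOn e S ≤ sigmaOn e S' :=
  iSup_le fun s => le_iSup (fun s : S' => MeasurableSpace.comap (e s) inferInstance) ⟨s, h s.2⟩

theorem measurable_sigmaOn {S : Set ℤ} {t : ℤ} (ht : t ∈ S) : Measurable[sigmaOn e S] (e t) :=
  Measurable.of_comap_le (le_iSup (fun s : S => MeasurableSpace.comap (e s) inferInstance) ⟨t, ht⟩)

variable [mΩ : MeasurableSpace Ω] {P : Measure Ω}

theorem sigmaOn_le (he : ∀ t, Measurable (e t)) (S : Set ℤ) : sigmaOn e S ≤ mΩ :=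
  iSup_le fun s => (he s).comap_le

theorem mixingCoeff_nonneg (ℓ : ℕ) : 0 ≤ mixingCoeff P e ℓ :=
  Real.sSup_nonneg (by rintro r ⟨t, A, B, -, -, rfl⟩; exact abs_nonneg _)

/-- A bound for the autocovariances at lag `n` of a bounded process with memory `J`. -/
def lagMixing (P : Measure Ω) (e : ℤ → Ω → E) (J n : ℕ) : ℝ :=
  if n < J then 1 else mixingCoeff P e (n - J)

theorem lagMixing_nonneg (J n : ℕ) : 0 ≤ lagMixing P e J n := by
  unfold lagMixing; split_ifs
  exacts [zero_le_one, mixingCoeff_nonneg _]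

theorem tendsto_lagMixing (hmix : Tendsto (mixingCoeff P e) atTop (𝓝 0)) (J : ℕ) :
    Tendsto (lagMixing P e J) atTop (𝓝 0) := by
  refine (hmix.comp (tendsto_sub_atTop_nat J)).congr' ?_
  filter_upwards [eventually_ge_atTop J] with n hn
  simp [lagMixing, not_lt.mpr hn]

variable [IsProbabilityMeasure P]

theorem abs_real_inter_sub_le_one (A B : Set Ω) :
    |P.real (A ∩ B) - P.real A * P.real B| ≤ 1 := by
  have h1 : P.real (A ∩ B) ≤ 1 := measureReal_le_one
  have h2 : P.real A * P.real B ≤ 1 :=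
    mul_le_one₀ measureReal_le_one measureReal_nonneg measureReal_le_one
  have h3 : 0 ≤ P.real A * P.real B := by positivity
  have h4 : 0 ≤ P.real (A ∩ B) := measureReal_nonneg
  rw [abs_le]; constructor <;> linarith

/-- A real `sSup` dominates its members only if the set is bounded above; here `1` is a bound. -/
theorem le_mixingCoeff {t : ℤ} {ℓ : ℕ} {A B : Set Ω}
    (hA : MeasurableSet[sigmaOn e (Set.Iic t)] A)
    (hB : MeasurableSet[sigmaOn e (Set.Ici (t + (ℓ : ℤ)))] B) :
    |P.real (A ∩ B) - P.real A * P.real B| ≤ mixingCoeff P e ℓ := by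
  refine le_csSup ⟨1, ?_⟩ ⟨t, A, B, hA, hB, rfl⟩
  rintro r ⟨t, A, B, -, -, rfl⟩
  exact abs_real_inter_sub_le_one A B

/-- For `s ≤ t` the variable `b s` uses innovations up to time `s` and `b t` those from time `t - J`
on, so a gap of `t - s - J` remains for mixing. When the windows overlap, the trivial bound `4 * M ^
2` explains the value `1` in `lagMixing`. -/
theorem abs_cov_le_lagMixing (he : ∀ t, Measurable (e t)) {J : ℕ} {M : ℝ} {b : ℤ → Ω → ℝ}
    (hbM : ∀ t ω, |b t ω| ≤ M)
    (hb : ∀ t, Measurable[sigmaOn e (Set.Icc (t - J) t)] (b t)) (s t : ℤ) :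
    |cov[b s, b t; P]| ≤ 4 * M ^ 2 * lagMixing P e J (s - t).natAbs := by
  wlog hst : s ≤ t generalizing s t
  · rw [covariance_comm, ← Int.natAbs_neg, neg_sub]
    exact this t s (le_of_not_ge hst)
  unfold lagMixing
  split_ifs with h
  · simpa using abs_cov_le_of_abs_le (hbM s) (hbM t)
  · refine abs_cov_le_of_bounded (sigmaOn_le he _) (sigmaOn_le he _)
      ((hb s).mono (sigmaOn_mono Set.Icc_subset_Iic_self) le_rfl)
      ((hb t).mono (sigmaOn_mono (S' := Set.Ici (s + (((s - t).natAbs - J : ℕ) : ℤ))) ?_) le_rfl)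
      (hbM s) (hbM t) fun A B hA hB => le_mixingCoeff hA hB
    intro r hr
    simp only [Set.mem_Icc, Set.mem_Ici] at hr ⊢
    omega

/-- Each lag `n` is attained by at most two times, `s + n` and `s - n`. -/
theorem sum_natAbs_sub_le {a : ℕ → ℝ} (ha : ∀ n, 0 ≤ a n) {T s : ℕ} (hs : s ∈ Finset.Icc 1 T) :
    ∑ t ∈ Finset.Icc 1 T, a ((s : ℤ) - t).natAbs ≤ 2 * ∑ n ∈ Finset.range T, a n := by
  rw [← Finset.sum_fiberwise_of_maps_to (t := Finset.range T)
    (g := fun t : ℕ => ((s : ℤ) - t).natAbs)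
    (fun t ht => by simp only [Finset.mem_Icc, Finset.mem_range] at *; omega), Finset.mul_sum]
  refine Finset.sum_le_sum fun n hn => ?_
  rw [Finset.sum_congr rfl (g := fun _ => a n)
    (fun t ht => by rw [(Finset.mem_filter.mp ht).2]), Finset.sum_const, nsmul_eq_mul]
  refine mul_le_mul_of_nonneg_right ?_ (ha n)
  have hsub : (Finset.Icc 1 T).filter (fun t : ℕ => ((s : ℤ) - t).natAbs = n) ⊆ {s + n, s - n} := by
    intro t ht
    simp only [Finset.mem_filter, Finset.mem_insert, Finset.mem_singleton] at *
    omega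
  exact_mod_cast (Finset.card_le_card hsub).trans Finset.card_le_two

/-- The variance of the average is at most `8 * M ^ 2` times the Cesàro mean of `lagMixing`, which
tends to `0`. No stationarity of `b` is needed, since each term is centred at its own mean. -/
theorem tendsto_integral_abs_average_of_bounded (he : ∀ t, Measurable (e t))
    (hmix : Tendsto (mixingCoeff P e) atTop (𝓝 0)) {J : ℕ} {M : ℝ} {b : ℤ → Ω → ℝ}
    (hbM : ∀ t ω, |b t ω| ≤ M)
    (hb : ∀ t, Measurable[sigmaOn e (Set.Icc (t - J) t)] (b t)) :
    Tendsto (fun T : ℕ => ∫ ω, |(T : ℝ)⁻¹ * ∑ t ∈ Finset.Icc 1 T, (b t ω - ∫ ω, b t ω ∂P)| ∂P)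
      atTop (𝓝 0) := by
  have hbm : ∀ t, MemLp (b t) 2 P := fun t =>
    MemLp.of_bound ((hb t).mono (sigmaOn_le he _) le_rfl).aestronglyMeasurable M
      (ae_of_all _ fun ω => by simpa using hbM t ω)
  have hbi : ∀ t, Integrable (b t) P := fun t => (hbm t).integrable one_le_two
  set c : ℕ → ℝ := fun T => (T : ℝ)⁻¹ * ∑ n ∈ Finset.range T, lagMixing P e J n with hc
  have hc0 : Tendsto c atTop (𝓝 0) := (tendsto_lagMixing hmix J).cesaro
  have hlim : Tendsto (fun T => √(8 * M ^ 2 * c T)) atTop (𝓝 0) := by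
    have := (hc0.const_mul (8 * M ^ 2)).sqrt
    simpa using this
  refine squeeze_zero (fun T => integral_nonneg fun ω => abs_nonneg _) (fun T => ?_) hlim
  let d : ℕ → Ω → ℝ := fun t => b t
  set S : Ω → ℝ := fun ω => (T : ℝ)⁻¹ * ∑ t ∈ Finset.Icc 1 T, (b t ω - ∫ ω, b t ω ∂P) with hS
  have hSm : MemLp S 2 P :=
    (memLp_finsetSum (f := fun t : ℕ => fun ω => b t ω - ∫ ω, b t ω ∂P) _
      fun t _ => (hbm t).sub (memLp_const _)).const_mul _
  have hsq : ∫ ω, S ω ^ 2 ∂P = (T : ℝ)⁻¹ ^ 2 * Var[∑ t ∈ Finset.Icc 1 T, d t; P] := by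
    rw [variance_eq_integral (Finset.aemeasurable_sum (f := d) _ fun t _ =>
      (hbi t).aestronglyMeasurable.aemeasurable), ← integral_const_mul]
    congr 1; ext ω
    simp only [hS, Finset.sum_apply, d]
    rw [integral_finsetSum (f := d) _ fun t _ => hbi t, ← Finset.sum_sub_distrib]; ring
  have hvar : Var[∑ t ∈ Finset.Icc 1 T, d t; P]
      ≤ T * (8 * M ^ 2 * ∑ n ∈ Finset.range T, lagMixing P e J n) := by
    rw [variance_sum' (X := d) fun t _ => hbm t]
    calc _ ≤ ∑ s ∈ Finset.Icc 1 T, (8 * M ^ 2 * ∑ n ∈ Finset.range T, lagMixing P e J n) := by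
          refine Finset.sum_le_sum fun s hs => ?_
          calc _ ≤ ∑ t ∈ Finset.Icc 1 T, 4 * M ^ 2 * lagMixing P e J ((s : ℤ) - t).natAbs :=
                Finset.sum_le_sum fun t _ =>
                  (le_abs_self _).trans (abs_cov_le_lagMixing he hbM hb s t)
            _ ≤ 4 * M ^ 2 * (2 * ∑ n ∈ Finset.range T, lagMixing P e J n) := by
                rw [← Finset.mul_sum]
                gcongr
                exact sum_natAbs_sub_le (lagMixing_nonneg J) hs
            _ = _ := by ring
      _ = _ := by simp
  have hle : ∫ ω, S ω ^ 2 ∂P ≤ 8 * M ^ 2 * c T := by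
    rw [hsq]
    rcases Nat.eq_zero_or_pos T with rfl | hT
    · simp [hc]
    · have hT' : (0 : ℝ) < T := by exact_mod_cast hT
      calc _ ≤ (T : ℝ)⁻¹ ^ 2 * (T * (8 * M ^ 2 * ∑ n ∈ Finset.range T, lagMixing P e J n)) := by
            gcongr
        _ = _ := by simp only [hc]; field_simp
  -- Jensen's inequality, in the form that the variance of `|S|` is nonnegative.
  have hjensen : (∫ ω, |S ω| ∂P) ^ 2 ≤ ∫ ω, S ω ^ 2 ∂P := by
    have h := variance_nonneg |S| P
    rw [variance_eq_sub hSm.abs] at h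
    simp only [Pi.pow_apply, Pi.abs_apply, sq_abs] at h
    linarith
  exact Real.le_sqrt_of_sq_le (hjensen.trans hle)

end Memory

/-! ### Uniform approximation by bounded finite-memory processes, and the law of large numbers in
`L¹`. -/

section Approximation

variable {Ω : Type*} [mΩ : MeasurableSpace Ω] {P : Measure Ω}
  {E : Type*} [MeasurableSpace E] {e : ℤ → Ω → E} {p : ℝ≥0∞} {V W : ℤ → Ω → ℝ}

/-- The real process `W` is a limit in `L^p`, uniformly in time, of bounded processes that are
functions of finitely many recent values of `e`. -/
structure IsApprox (P : Measure Ω) (e : ℤ → Ω → E) (p : ℝ≥0∞) (W : ℤ → Ω → ℝ) : Prop where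
  aesm : ∀ t, AEStronglyMeasurable (W t) P
  approx : ∀ η : ℝ≥0, 0 < η → ∃ (J : ℕ) (M : ℝ≥0) (b : ℤ → Ω → ℝ), (∀ t ω, |b t ω| ≤ M) ∧
    (∀ t, Measurable[sigmaOn e (Set.Icc (t - J) t)] (b t)) ∧
    ∀ t, eLpNorm (W t - b t) p P ≤ η

theorem IsApprox.congr (hW : IsApprox P e p W) (h : ∀ t, W t =ᵐ[P] V t) : IsApprox P e p V where
  aesm t := (hW.aesm t).congr (h t)
  approx η hη := by
    obtain ⟨J, M, b, h1, h2, h3⟩ := hW.approx η hη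
    refine ⟨J, M, b, h1, h2, fun t => ?_⟩
    rw [← eLpNorm_congr_ae ((h t).sub EventuallyEq.rfl)]
    exact h3 t

theorem IsApprox.of_uniform_limit (hp : 1 ≤ p) (he : ∀ t, Measurable (e t))
    (hW : ∀ t, AEStronglyMeasurable (W t) P)
    (h : ∀ η : ℝ≥0, 0 < η → ∃ V, IsApprox P e p V ∧ ∀ t, eLpNorm (W t - V t) p P ≤ η) :
    IsApprox P e p W where
  aesm := hW
  approx η hη := by
    obtain ⟨V, hV, hWV⟩ := h (η / 2) (by positivity)
    obtain ⟨J, M, b, h1, h2, h3⟩ := hV.approx (η / 2) (by positivity)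
    refine ⟨J, M, b, h1, h2, fun t => ?_⟩
    have hbm := ((h2 t).mono (sigmaOn_le he _) le_rfl).aestronglyMeasurable (μ := P)
    calc eLpNorm (W t - b t) p P = eLpNorm ((W t - V t) + (V t - b t)) p P := by simp
      _ ≤ eLpNorm (W t - V t) p P + eLpNorm (V t - b t) p P :=
          eLpNorm_add_le ((hW t).sub (hV.aesm t)) ((hV.aesm t).sub hbm) hp
      _ ≤ ((η / 2 : ℝ≥0) : ℝ≥0∞) + (η / 2 : ℝ≥0) := add_le_add (hWV t) (h3 t)
      _ = η := by rw [← ENNReal.coe_add, add_halves]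

theorem isApprox_const (c : ℝ) : IsApprox P e p fun _ _ => c where
  aesm _ := aestronglyMeasurable_const
  approx η _ := ⟨0, ‖c‖₊, fun _ _ => c, fun _ _ => le_of_eq (by simp), fun _ => measurable_const,
    fun t => by simp⟩

theorem IsApprox.add (hp : 1 ≤ p) (he : ∀ t, Measurable (e t))
    (hV : IsApprox P e p V) (hW : IsApprox P e p W) :
    IsApprox P e p fun t ω => V t ω + W t ω where
  aesm t := (hV.aesm t).add (hW.aesm t)
  approx η hη := by
    obtain ⟨J, M, b, h1, h2, h3⟩ := hV.approx (η / 2) (by positivity)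
    obtain ⟨J', M', b', h1', h2', h3'⟩ := hW.approx (η / 2) (by positivity)
    have hbm := fun t => ((h2 t).mono (sigmaOn_le he _) le_rfl).aestronglyMeasurable (μ := P)
    have hbm' := fun t => ((h2' t).mono (sigmaOn_le he _) le_rfl).aestronglyMeasurable (μ := P)
    refine ⟨max J J', M + M', fun t => b t + b' t, fun t ω => ?_, fun t => ?_, fun t => ?_⟩
    · push_cast
      exact (abs_add_le _ _).trans (add_le_add (h1 t ω) (h1' t ω))
    · refine Measurable.add ((h2 t).mono (sigmaOn_mono ?_) le_rfl)
        ((h2' t).mono (sigmaOn_mono ?_) le_rfl) <;>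
      · refine Set.Icc_subset_Icc_left ?_
        omega
    · calc eLpNorm ((fun ω => V t ω + W t ω) - (b t + b' t)) p P
          = eLpNorm ((V t - b t) + (W t - b' t)) p P := by
            congr 1; ext ω; simp only [Pi.sub_apply, Pi.add_apply]; ring
        _ ≤ eLpNorm (V t - b t) p P + eLpNorm (W t - b' t) p P :=
          eLpNorm_add_le ((hV.aesm t).sub (hbm t)) ((hW.aesm t).sub (hbm' t)) hp
        _ ≤ ((η / 2 : ℝ≥0) : ℝ≥0∞) + (η / 2 : ℝ≥0) := add_le_add (h3 t) (h3' t)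
        _ = η := by rw [← ENNReal.coe_add, add_halves]

theorem IsApprox.sum {κ : Type*} (hp : 1 ≤ p) (he : ∀ t, Measurable (e t)) (s : Finset κ)
    {V : κ → ℤ → Ω → ℝ} (hV : ∀ i ∈ s, IsApprox P e p (V i)) :
    IsApprox P e p fun t ω => ∑ i ∈ s, V i t ω := by
  classical
  induction s using Finset.induction_on with
  | empty => simpa using isApprox_const 0
  | insert i s hi ih =>
    simp only [Finset.sum_insert hi]
    exact (hV i (by simp)).add hp he (ih fun j hj => hV j (by simp [hj]))

theorem IsApprox.const_mul (c : ℝ) (hW : IsApprox P e p W) :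
    IsApprox P e p fun t ω => c * W t ω where
  aesm t := (hW.aesm t).const_mul c
  approx η hη := by
    -- Adding `1` keeps the tolerance meaningful when `c = 0`.
    obtain ⟨J, M, b, h1, h2, h3⟩ := hW.approx (η / (‖c‖₊ + 1)) (by positivity)
    refine ⟨J, ‖c‖₊ * M, fun t => c • b t, fun t ω => ?_, fun t => (h2 t).const_smul c,
      fun t => ?_⟩
    · simp only [Pi.smul_apply, smul_eq_mul, abs_mul, NNReal.coe_mul, coe_nnnorm, Real.norm_eq_abs]
      gcongr
      exact h1 t ω
    · calc eLpNorm ((fun ω => c * W t ω) - c • b t) p P = eLpNorm (c • (W t - b t)) p P := by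
            congr 1; ext ω; simp; ring
        _ ≤ ‖c‖ₑ * (η / (‖c‖₊ + 1) : ℝ≥0) := by
            rw [eLpNorm_const_smul]; gcongr; exact h3 t
        _ ≤ η := by
            rw [enorm_eq_nnnorm, ← ENNReal.coe_mul, ENNReal.coe_le_coe]
            calc ‖c‖₊ * (η / (‖c‖₊ + 1)) ≤ (‖c‖₊ + 1) * (η / (‖c‖₊ + 1)) := by gcongr; simp
              _ = η := mul_div_cancel₀ _ (by positivity)

theorem IsApprox.shift (j : ℕ) (hW : IsApprox P e p W) : IsApprox P e p fun t => W (t - j) where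
  aesm t := hW.aesm _
  approx η hη := by
    obtain ⟨J, M, b, h1, h2, h3⟩ := hW.approx η hη
    refine ⟨J + j, M, fun t => b (t - j), fun t => h1 _, fun t => ?_, fun t => h3 _⟩
    refine (h2 (t - j)).mono (sigmaOn_mono (Set.Icc_subset_Icc ?_ ?_)) le_rfl
    · push_cast; linarith
    · simp

/-- Write `V W - b b' = (V - b) W + b (W - b')` and apply Hölder to each term. This needs bounds on
`W` in `L²` and on `b` that are uniform in time. -/
theorem IsApprox.mul [IsProbabilityMeasure P] (he : ∀ t, Measurable (e t))
    (hV : IsApprox P e 2 V) (hW : IsApprox P e 2 W) :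
    IsApprox P e 1 fun t ω => V t ω * W t ω where
  aesm t := (hV.aesm t).mul (hW.aesm t)
  approx η hη := by
    have holder : ∀ f g : Ω → ℝ, AEStronglyMeasurable f P → AEStronglyMeasurable g P →
        eLpNorm (f * g) 1 P ≤ eLpNorm f 2 P * eLpNorm g 2 P := fun f g hf hg => by
      simpa [smul_eq_mul] using eLpNorm_smul_le_mul_eLpNorm (p := 2) (q := 2) (r := 1) hg hf
    have bdd : ∀ (f : Ω → ℝ) (C : ℝ≥0), (∀ ω, |f ω| ≤ C) → eLpNorm f 2 P ≤ C := fun f C hf => by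
      refine (eLpNorm_le_of_ae_bound (C := C) (ae_of_all _ fun ω => by simpa using hf ω)).trans ?_
      simp
    -- This crude approximation serves only to bound `W t` in `L²` uniformly in `t`.
    obtain ⟨J₀, M₀, b₀, h1₀, h2₀, h3₀⟩ := hW.approx 1 one_pos
    have hW2 : ∀ t, eLpNorm (W t) 2 P ≤ (1 + M₀ : ℝ≥0) := fun t => by
      have hbm := ((h2₀ t).mono (sigmaOn_le he _) le_rfl).aestronglyMeasurable (μ := P)
      calc eLpNorm (W t) 2 P = eLpNorm ((W t - b₀ t) + b₀ t) 2 P := by simp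
        _ ≤ eLpNorm (W t - b₀ t) 2 P + eLpNorm (b₀ t) 2 P :=
            eLpNorm_add_le ((hW.aesm t).sub hbm) hbm one_le_two
        _ ≤ (1 : ℝ≥0) + (M₀ : ℝ≥0∞) := add_le_add (h3₀ t) (bdd _ _ (h1₀ t))
        _ = _ := by simp
    -- The order of choice matters: `b` is fixed first, and the accuracy of `b'` then depends on the
    -- bound `M` of `b`.
    obtain ⟨J, M, b, h1, h2, h3⟩ := hV.approx (η / 2 / (1 + M₀)) (by positivity)
    obtain ⟨J', M', b', h1', h2', h3'⟩ := hW.approx (η / 2 / (1 + M)) (by positivity)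
    have hbm := fun t => ((h2 t).mono (sigmaOn_le he _) le_rfl).aestronglyMeasurable (μ := P)
    have hbm' := fun t => ((h2' t).mono (sigmaOn_le he _) le_rfl).aestronglyMeasurable (μ := P)
    refine ⟨max J J', M * M', fun t => b t * b' t, fun t ω => ?_, fun t => ?_, fun t => ?_⟩
    · simp only [Pi.mul_apply, abs_mul, NNReal.coe_mul]
      exact mul_le_mul (h1 t ω) (h1' t ω) (abs_nonneg _) M.2
    · refine Measurable.mul ((h2 t).mono (sigmaOn_mono ?_) le_rfl)
        ((h2' t).mono (sigmaOn_mono ?_) le_rfl) <;>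
      · refine Set.Icc_subset_Icc_left ?_
        omega
    · have hd := (hV.aesm t).sub (hbm t)
      have hd' := (hW.aesm t).sub (hbm' t)
      calc eLpNorm ((fun ω => V t ω * W t ω) - (b t * b' t)) 1 P
          = eLpNorm ((V t - b t) * W t + b t * (W t - b' t)) 1 P := by
            congr 1; ext ω; simp only [Pi.sub_apply, Pi.add_apply, Pi.mul_apply]; ring
        _ ≤ eLpNorm ((V t - b t) * W t) 1 P + eLpNorm (b t * (W t - b' t)) 1 P :=
          eLpNorm_add_le (hd.mul (hW.aesm t)) ((hbm t).mul hd') le_rfl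
        _ ≤ (η / 2 / (1 + M₀) : ℝ≥0) * (1 + M₀ : ℝ≥0) + (M : ℝ≥0∞) * (η / 2 / (1 + M) : ℝ≥0) :=
          add_le_add ((holder _ _ hd (hW.aesm t)).trans (mul_le_mul' (h3 t) (hW2 t)))
            ((holder _ _ (hbm t) hd').trans (mul_le_mul' (bdd _ _ (h1 t)) (h3' t)))
        _ ≤ η := by
          rw [← ENNReal.coe_mul, ← ENNReal.coe_mul, ← ENNReal.coe_add, ENNReal.coe_le_coe,
            div_mul_cancel₀ _ (by positivity)]
          calc _ ≤ η / 2 + (1 + M) * (η / 2 / (1 + M)) := by gcongr; simp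
            _ = η := by rw [mul_div_cancel₀ _ (by positivity), add_halves]

/-- Law of large numbers in `L¹`. -/
theorem IsApprox.tendsto_integral_abs_average [IsProbabilityMeasure P]
    (he : ∀ t, Measurable (e t)) (hmix : Tendsto (mixingCoeff P e) atTop (𝓝 0))
    (hW : IsApprox P e 1 W) :
    Tendsto (fun T : ℕ => ∫ ω, |(T : ℝ)⁻¹ * ∑ t ∈ Finset.Icc 1 T, (W t ω - ∫ ω, W t ω ∂P)| ∂P)
      atTop (𝓝 0) := by
  rw [Metric.tendsto_atTop]
  intro r hr
  lift r to ℝ≥0 using hr.le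
  replace hr : 0 < r := by exact_mod_cast hr
  -- Centring at most doubles the `L¹` error, so it contributes `r / 2`; the bounded part
  -- contributes less than another `r / 2` for large `T`.
  obtain ⟨J, M, b, h1, h2, h3⟩ := hW.approx (r / 4) (by positivity)
  have hbi : ∀ t, Integrable (b t) P := fun t =>
    Integrable.of_bound ((h2 t).mono (sigmaOn_le he _) le_rfl).aestronglyMeasurable M
      (ae_of_all _ fun ω => by simpa using h1 t ω)
  have hdi : ∀ t, Integrable (W t - b t) P := fun t =>
    memLp_one_iff_integrable.mp ⟨(hW.aesm t).sub (hbi t).1, (h3 t).trans_lt ENNReal.coe_lt_top⟩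
  have hWi : ∀ t, Integrable (W t) P := fun t => by simpa using (hdi t).add (hbi t)
  have hd1 : ∀ t, ∫ ω, |W t ω - b t ω| ∂P ≤ r / 4 := fun t => by
    have := h3 t
    rw [eLpNorm_one_eq_lintegral_enorm, ← ofReal_integral_norm_eq_lintegral_enorm (hdi t),
      ENNReal.ofReal_le_iff_le_toReal ENNReal.coe_ne_top] at this
    simpa using this
  set d : ℤ → Ω → ℝ := fun t ω => (W t ω - b t ω) - ∫ ω, (W t ω - b t ω) ∂P with hd
  have hdint : ∀ t, Integrable (d t) P := fun t => (hdi t).sub (integrable_const _)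
  have hdle : ∀ t, ∫ ω, |d t ω| ∂P ≤ r / 2 := fun t => by
    calc ∫ ω, |d t ω| ∂P ≤ ∫ ω, (|W t ω - b t ω| + |∫ ω, (W t ω - b t ω) ∂P|) ∂P :=
          integral_mono (hdint t).abs ((hdi t).abs.add (integrable_const _))
            fun ω => abs_sub _ _
      _ = ∫ ω, |W t ω - b t ω| ∂P + |∫ ω, (W t ω - b t ω) ∂P| := by
          rw [integral_add (f := fun ω => |W t ω - b t ω|) (hdi t).abs (integrable_const _)]; simp
      _ ≤ r / 4 + r / 4 :=
          add_le_add (hd1 t) (abs_integral_le_integral_abs.trans (hd1 t))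
      _ = r / 2 := by ring
  have hb := tendsto_integral_abs_average_of_bounded he hmix h1 h2
  rw [Metric.tendsto_atTop] at hb
  obtain ⟨T₀, hT₀⟩ := hb (r / 2) (by positivity)
  refine ⟨T₀, fun T hT => ?_⟩
  have hbT := hT₀ T hT
  rw [Real.dist_eq, sub_zero, abs_of_nonneg (integral_nonneg fun _ => abs_nonneg _)] at hbT ⊢
  have hI1 : Integrable (fun ω => (T : ℝ)⁻¹ * ∑ t ∈ Finset.Icc 1 T, (b t ω - ∫ ω, b t ω ∂P)) P :=
    (integrable_finsetSum (f := fun t : ℕ => fun ω => b t ω - ∫ ω, b t ω ∂P) _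
      fun t _ => (hbi t).sub (integrable_const _)).const_mul _
  have hI2 : Integrable (fun ω => ∑ t ∈ Finset.Icc 1 T, |d t ω|) P :=
    integrable_finsetSum (f := fun t : ℕ => fun ω => |d t ω|) _ fun t _ => (hdint t).abs
  have hT1 : (T : ℝ)⁻¹ * T ≤ 1 := by
    rcases Nat.eq_zero_or_pos T with rfl | h
    · simp
    · exact (inv_mul_cancel₀ (by positivity)).le
  calc _ ≤ ∫ ω, (|(T : ℝ)⁻¹ * ∑ t ∈ Finset.Icc 1 T, (b t ω - ∫ ω, b t ω ∂P)|
          + (T : ℝ)⁻¹ * ∑ t ∈ Finset.Icc 1 T, |d t ω|) ∂P := by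
        refine integral_mono_of_nonneg (ae_of_all _ fun ω => abs_nonneg _)
          (hI1.abs.add (hI2.const_mul _)) (ae_of_all _ fun ω => ?_)
        have : (T : ℝ)⁻¹ * ∑ t ∈ Finset.Icc 1 T, (W t ω - ∫ ω, W t ω ∂P)
            = (T : ℝ)⁻¹ * ∑ t ∈ Finset.Icc 1 T, (b t ω - ∫ ω, b t ω ∂P)
              + (T : ℝ)⁻¹ * ∑ t ∈ Finset.Icc 1 T, d t ω := by
          rw [← mul_add, ← Finset.sum_add_distrib]
          congr 1
          refine Finset.sum_congr rfl fun t _ => ?_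
          simp only [hd]
          rw [integral_sub (hWi t) (hbi t)]; ring
        simp only [this]
        refine (abs_add_le _ _).trans (add_le_add le_rfl ?_)
        rw [abs_mul, abs_of_nonneg (by positivity : (0 : ℝ) ≤ (T : ℝ)⁻¹)]
        gcongr
        exact Finset.abs_sum_le_sum_abs _ _
    _ = ∫ ω, |(T : ℝ)⁻¹ * ∑ t ∈ Finset.Icc 1 T, (b t ω - ∫ ω, b t ω ∂P)| ∂P
          + (T : ℝ)⁻¹ * ∑ t ∈ Finset.Icc 1 T, ∫ ω, |d t ω| ∂P := by
        rw [integral_add hI1.abs (hI2.const_mul _), integral_const_mul,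
          integral_finsetSum (f := fun t : ℕ => fun ω => |d t ω|) _ fun t _ => (hdint t).abs]
    _ < r / 2 + (T : ℝ)⁻¹ * (T * (r / 2)) := by
        refine add_lt_add_of_lt_of_le hbT ?_
        gcongr
        calc _ ≤ ∑ t ∈ Finset.Icc 1 T, (r / 2 : ℝ) := Finset.sum_le_sum fun t _ => hdle t
          _ = _ := by simp
    _ ≤ r / 2 + 1 * (r / 2) := by rw [← mul_assoc]; gcongr
    _ = r := by ring

end Approximation

/-! ### Projections, matrix actions and finite linear filters in `L²`. -/

section Hilbert

/-- Projections onto a decreasing sequence of subspaces with trivial intersection tend to `0`. -/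
theorem tendsto_starProjection_of_iInf_eq_bot {H : Type*} [NormedAddCommGroup H]
    [InnerProductSpace ℝ H] [CompleteSpace H] (K : ℕ → Submodule ℝ H)
    [∀ n, (K n).HasOrthogonalProjection] (hK : Antitone K) (hbot : ⨅ n, K n = ⊥) (v : H) :
    Tendsto (fun n => (K n).starProjection v) atTop (𝓝 0) := by
  -- Dually, the orthogonal complements increase to a dense union, so the projections onto them
  -- converge to the identity.
  have hmono : Monotone fun n => (K n)ᗮ := fun i j h => Submodule.orthogonal_le (hK h)
  have hsup : (⨆ n, (K n)ᗮ)ᗮ = ⊥ := by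
    rw [← Submodule.iInf_orthogonal]
    simpa using hbot
  have htop : ⊤ ≤ (⨆ n, (K n)ᗮ).topologicalClosure :=
    (Submodule.topologicalClosure_eq_top_iff.mpr hsup).ge
  have h := (Submodule.starProjection_tendsto_self (fun n => (K n)ᗮ) hmono v htop).const_sub v
  simpa using h

variable {Ω : Type*} [MeasurableSpace Ω] {P : Measure Ω} {ι : Type*} [Fintype ι]

/-- The action of constant linear maps on square-integrable random vectors. -/
def act (P : Measure Ω) : (EuclideanSpace ℝ ι →L[ℝ] EuclideanSpace ℝ ι) →L[ℝ]
    Lp (EuclideanSpace ℝ ι) 2 P →L[ℝ] Lp (EuclideanSpace ℝ ι) 2 P :=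
  (ContinuousLinearMap.id ℝ (EuclideanSpace ℝ ι →L[ℝ] EuclideanSpace ℝ ι)).compLpL₂ 2 P

theorem coeFn_act (A : EuclideanSpace ℝ ι →L[ℝ] EuclideanSpace ℝ ι)
    (f : Lp (EuclideanSpace ℝ ι) 2 P) : act P A f =ᵐ[P] fun ω => A (f ω) :=
  A.coeFn_compLp f

theorem eq_act_iff {A : EuclideanSpace ℝ ι →L[ℝ] EuclideanSpace ℝ ι}
    {f V : Lp (EuclideanSpace ℝ ι) 2 P} : V = act P A f ↔ V =ᵐ[P] fun ω => A (f ω) :=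
  ⟨fun h => h ▸ coeFn_act A f, fun h => Lp.ext (h.trans (coeFn_act A f).symm)⟩

theorem act_act (A B : EuclideanSpace ℝ ι →L[ℝ] EuclideanSpace ℝ ι)
    (f : Lp (EuclideanSpace ℝ ι) 2 P) : act P A (act P B f) = act P (A.comp B) f := by
  rw [eq_act_iff]
  filter_upwards [coeFn_act A (act P B f), coeFn_act B f] with ω h1 h2
  rw [h1, h2]; rfl

theorem act_id (f : Lp (EuclideanSpace ℝ ι) 2 P) :
    act P (ContinuousLinearMap.id ℝ _) f = f := by
  symm; rw [eq_act_iff]; rfl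

theorem inner_act_left (A : EuclideanSpace ℝ ι →L[ℝ] EuclideanSpace ℝ ι)
    (f g : Lp (EuclideanSpace ℝ ι) 2 P) :
    inner ℝ (act P A f) g = inner ℝ f (act P (ContinuousLinearMap.adjoint A) g) := by
  rw [L2.inner_def, L2.inner_def]
  refine integral_congr_ae ?_
  filter_upwards [coeFn_act A f, coeFn_act (ContinuousLinearMap.adjoint A) g] with ω h1 h2
  rw [h1, h2, ContinuousLinearMap.adjoint_inner_right]

/-- The span of the families `t ↦ A ζ_{t+s}`, `s ∈ S`: the outputs of finite linear filters with
lags in `S` applied to `ζ`. -/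
def filterSpan (ζ : ℤ → Lp (EuclideanSpace ℝ ι) 2 P) (S : Set ℤ) :
    Submodule ℝ (ℤ → Lp (EuclideanSpace ℝ ι) 2 P) :=
  Submodule.span ℝ {V | ∃ s ∈ S, ∃ A, V = fun t => act P A (ζ (t + s))}

variable {ζ V W : ℤ → Lp (EuclideanSpace ℝ ι) 2 P} {S S' : Set ℤ}

theorem act_mem_filterSpan {s : ℤ} (hs : s ∈ S)
    (A : EuclideanSpace ℝ ι →L[ℝ] EuclideanSpace ℝ ι) :
    (fun t => act P A (ζ (t + s))) ∈ filterSpan ζ S :=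
  Submodule.subset_span ⟨s, hs, A, rfl⟩

theorem self_mem_filterSpan (hS : 0 ∈ S) : ζ ∈ filterSpan ζ S := by
  simpa [act_id] using act_mem_filterSpan (ζ := ζ) hS (ContinuousLinearMap.id ℝ _)

theorem filterSpan_mono (h : S ⊆ S') : filterSpan ζ S ≤ filterSpan ζ S' :=
  Submodule.span_mono fun _ ⟨s, hs, A, hV⟩ => ⟨s, h hs, A, hV⟩

/-- Elements of `filterSpan` are whole families with the same coefficients at every time, so a time
shift only relabels the lags. -/
theorem shift_mem_filterSpan (hV : V ∈ filterSpan ζ S) {r : ℤ} (h : ∀ s ∈ S, r + s ∈ S') :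
    (fun t => V (t + r)) ∈ filterSpan ζ S' := by
  induction hV using Submodule.span_induction with
  | mem V hV =>
    obtain ⟨s, hs, A, rfl⟩ := hV
    simpa only [add_assoc] using act_mem_filterSpan (ζ := ζ) (h s hs) A
  | zero => exact (filterSpan ζ S').zero_mem
  | add V W _ _ hV hW => exact (filterSpan ζ S').add_mem hV hW
  | smul c V _ hV => exact (filterSpan ζ S').smul_mem c hV

theorem act_apply_mem_filterSpan (hV : V ∈ filterSpan ζ S)
    (A : EuclideanSpace ℝ ι →L[ℝ] EuclideanSpace ℝ ι) :
    (fun t => act P A (V t)) ∈ filterSpan ζ S := by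
  induction hV using Submodule.span_induction with
  | mem V hV =>
    obtain ⟨s, hs, B, rfl⟩ := hV
    simpa only [act_act] using act_mem_filterSpan (ζ := ζ) hs (A.comp B)
  | zero => simp only [Pi.zero_apply, map_zero]; exact (filterSpan ζ S).zero_mem
  | add V W _ _ hV hW => simp only [Pi.add_apply, map_add]; exact (filterSpan ζ S).add_mem hV hW
  | smul c V _ hV => simp only [Pi.smul_apply, map_smul]; exact (filterSpan ζ S).smul_mem c hV

/-- Second moments of filtered families are invariant under time shifts. -/
theorem inner_filterSpan
    (hζ : ∀ s r t A B, inner ℝ (act P A (ζ (t + s))) (act P B (ζ (t + r)))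
      = inner ℝ (act P A (ζ (0 + s))) (act P B (ζ (0 + r))))
    (hV : V ∈ filterSpan ζ S) (hW : W ∈ filterSpan ζ S') (t : ℤ) :
    inner ℝ (V t) (W t) = inner ℝ (V 0) (W 0) := by
  induction hV using Submodule.span_induction with
  | mem V hV =>
    obtain ⟨s, -, A, rfl⟩ := hV
    induction hW using Submodule.span_induction with
    | mem W hW =>
      obtain ⟨r, -, B, rfl⟩ := hW
      exact hζ s r t A B
    | zero => simp
    | add V W _ _ hV hW => simp only [Pi.add_apply, inner_add_right, hV, hW]
    | smul c V _ hV => simp only [Pi.smul_apply, inner_smul_right, hV]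
  | zero => simp
  | add V W _ _ hV hW => simp only [Pi.add_apply, inner_add_left, hV, hW]
  | smul c V _ hV => simp only [Pi.smul_apply, real_inner_smul_left, hV]

end Hilbert

/-! ### Truncated Wold decomposition. -/

section Wold

variable {Ω : Type*} [MeasurableSpace Ω] {P : Measure Ω} {ι : Type*} [Fintype ι]
  {z : ℤ → Ω → EuclideanSpace ℝ ι}

/-- The process as a family in `L²`. -/
def toL2 (hz : ∀ t, MemLp (z t) 2 P) (t : ℤ) : Lp (EuclideanSpace ℝ ι) 2 P := (hz t).toLp (z t)

theorem setOf_generators_eq (hz : ∀ t, MemLp (z t) 2 P) (S : Set ℤ) :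
    {V : Lp (EuclideanSpace ℝ ι) 2 P | ∃ s ∈ S,
      ∃ A : EuclideanSpace ℝ ι →L[ℝ] EuclideanSpace ℝ ι, V =ᵐ[P] fun ω => A (z s ω)}
      = {V | ∃ s ∈ S, ∃ A, V = act P A (toL2 hz s)} := by
  have key : ∀ (s : ℤ) (A : EuclideanSpace ℝ ι →L[ℝ] EuclideanSpace ℝ ι)
      (V : Lp (EuclideanSpace ℝ ι) 2 P),
      (V =ᵐ[P] fun ω => A (z s ω)) ↔ V = act P A (toL2 hz s) := fun s A V => by
    rw [eq_act_iff]
    have h : (fun ω => A (z s ω)) =ᵐ[P] fun ω => A (toL2 hz s ω) :=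
      (MemLp.coeFn_toLp (hz s)).symm.fun_comp A
    exact ⟨fun h' => h'.trans h, fun h' => h'.trans h.symm⟩
  ext V
  simp only [Set.mem_ofPred_eq, key]

theorem closedSpan_eq (hz : ∀ t, MemLp (z t) 2 P) (S : Set ℤ) :
    closedSpan P z S = (Submodule.span ℝ
      {V | ∃ s ∈ S, ∃ A, V = act P A (toL2 hz s)}).topologicalClosure := by
  rw [closedSpan, setOf_generators_eq hz]

/-- Orthogonality needs testing on generators only. This is what lets it be transported in time
through `inner_filterSpan`. -/
theorem mem_orthogonal_closedSpan_iff (hz : ∀ t, MemLp (z t) 2 P) {S : Set ℤ}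
    {v : Lp (EuclideanSpace ℝ ι) 2 P} :
    v ∈ (closedSpan P z S)ᗮ ↔ ∀ s ∈ S, ∀ A, inner ℝ (act P A (toL2 hz s)) v = 0 := by
  rw [closedSpan_eq hz, Submodule.orthogonal_closure]
  refine ⟨fun h s hs A => h _ (Submodule.subset_span ⟨s, hs, A, rfl⟩), fun h w hw => ?_⟩
  induction hw using Submodule.span_induction with
  | mem V hV => obtain ⟨s, hs, A, rfl⟩ := hV; exact h s hs A
  | zero => simp
  | add V W _ _ hV hW => simp only [inner_add_left, hV, hW, add_zero]
  | smul c V _ hV => simp only [real_inner_smul_left, hV, mul_zero]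

/-- The span has matrix coefficients, so it is stable under every adjoint matrix; hence its
complement is stable under every matrix. -/
theorem act_mem_orthogonal_closedSpan (hz : ∀ t, MemLp (z t) 2 P) {S : Set ℤ}
    {v : Lp (EuclideanSpace ℝ ι) 2 P} (hv : v ∈ (closedSpan P z S)ᗮ)
    (A : EuclideanSpace ℝ ι →L[ℝ] EuclideanSpace ℝ ι) : act P A v ∈ (closedSpan P z S)ᗮ := by
  rw [mem_orthogonal_closedSpan_iff hz] at hv ⊢
  intro s hs B
  rw [real_inner_comm, inner_act_left, real_inner_comm, act_act]
  exact hv s hs _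

theorem closedSpan_mono {S S' : Set ℤ} (h : S ⊆ S') : closedSpan P z S ≤ closedSpan P z S' :=
  Submodule.topologicalClosure_mono (Submodule.span_mono fun _ ⟨s, hs, A, hV⟩ => ⟨s, h hs, A, hV⟩)

theorem filterSpan_apply_mem_pastSpace (hz : ∀ t, MemLp (z t) 2 P)
    {V : ℤ → Lp (EuclideanSpace ℝ ι) 2 P} {r : ℤ}
    (hV : V ∈ filterSpan (toL2 hz) (Set.Iic r)) (t : ℤ) : V t ∈ pastSpace P z (t + r) := by
  rw [pastSpace, closedSpan_eq hz]
  refine Submodule.le_topologicalClosure _ ?_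
  induction hV using Submodule.span_induction with
  | mem V hV =>
    obtain ⟨s, hs, A, rfl⟩ := hV
    exact Submodule.subset_span ⟨t + s, by simpa using hs, A, rfl⟩
  | zero => exact Submodule.zero_mem _
  | add V W _ _ hV hW => exact Submodule.add_mem _ hV hW
  | smul c V _ hV => exact Submodule.smul_mem _ c hV

/-- The span of finitely many lags needs no closure. -/
theorem exists_filterSpan_apply_zero_eq (hz : ∀ t, MemLp (z t) 2 P) {S : Set ℤ} (hS : S.Finite)
    {v : Lp (EuclideanSpace ℝ ι) 2 P} (hv : v ∈ closedSpan P z S) :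
    ∃ V ∈ filterSpan (toL2 hz) S, V 0 = v := by
  rw [closedSpan_eq hz] at hv
  set F := Submodule.span ℝ {V | ∃ s ∈ S, ∃ A, V = act P A (toL2 hz s)} with hF
  -- Each summand is the image of the finite-dimensional space of matrices under `A ↦ act P A (toL2
  -- hz s)`, so `F` is finite-dimensional and thus closed.
  have hle : F ≤ ⨆ s : S, LinearMap.range ((act P).flip (toL2 hz s)).toLinearMap := by
    refine Submodule.span_le.mpr ?_
    rintro _ ⟨s, hs, A, rfl⟩
    exact Submodule.mem_iSup_of_mem (⟨s, hs⟩ : S) ⟨A, rfl⟩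
  have : Finite S := hS
  have : FiniteDimensional ℝ F := Submodule.finiteDimensional_of_le hle
  rw [IsClosed.submodule_topologicalClosure_eq F.closed_of_finiteDimensional] at hv
  induction hv using Submodule.span_induction with
  | mem V hV =>
    obtain ⟨s, hs, A, rfl⟩ := hV
    exact ⟨_, act_mem_filterSpan hs A, by simp⟩
  | zero => exact ⟨0, Submodule.zero_mem _, rfl⟩
  | add V W _ _ hV hW =>
    obtain ⟨V', hV', rfl⟩ := hV
    obtain ⟨W', hW', rfl⟩ := hW
    exact ⟨_, Submodule.add_mem _ hV' hW', rfl⟩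
  | smul c V _ hV =>
    obtain ⟨V', hV', rfl⟩ := hV
    exact ⟨_, Submodule.smul_mem _ c hV', rfl⟩

/-- In coordinates the inner product is a fixed combination of second moments. As the mean vanishes,
these are autocovariances at lag `s - r`, which do not depend on `t`. -/
theorem inner_act_toL2 (hz : IsCovStationary P z) [IsProbabilityMeasure P]
    (hmean : ∀ t a, ∫ ω, z t ω a ∂P = 0) (s r t : ℤ)
    (A B : EuclideanSpace ℝ ι →L[ℝ] EuclideanSpace ℝ ι) :
    inner ℝ (act P A (toL2 hz.memLp (t + s))) (act P B (toL2 hz.memLp (t + r)))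
      = inner ℝ (act P A (toL2 hz.memLp (0 + s))) (act P B (toL2 hz.memLp (0 + r))) := by
  classical
  have hcoord : ∀ t a, MemLp (fun ω => z t ω a) 2 P := fun t a =>
    (EuclideanSpace.proj (𝕜 := ℝ) a).comp_memLp' (hz.memLp t)
  let δ : ι → EuclideanSpace ℝ ι := fun a => EuclideanSpace.single a 1
  have key : ∀ t, inner ℝ (act P A (toL2 hz.memLp (t + s))) (act P B (toL2 hz.memLp (t + r)))
      = ∑ a, ∑ b, inner ℝ (A (δ a)) (B (δ b))
        * cov[fun ω => z (t + s) ω a, fun ω => z (t + r) ω b; P] := by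
    intro t
    have hint : ∀ a b, Integrable (fun ω => z (t + s) ω a * z (t + r) ω b) P := fun a b =>
      (hcoord (t + s) a).integrable_mul (hcoord (t + r) b)
    have hexp : ∀ v : EuclideanSpace ℝ ι, v = ∑ a, v a • δ a := fun v => by
      simpa using ((EuclideanSpace.basisFun ι ℝ).sum_repr v).symm
    rw [L2.inner_def]
    calc _ = ∫ ω, ∑ a, ∑ b, inner ℝ (A (δ a)) (B (δ b)) * (z (t + s) ω a * z (t + r) ω b) ∂P := by
          refine integral_congr_ae ?_
          filter_upwards [coeFn_act A (toL2 hz.memLp (t + s)),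
            coeFn_act B (toL2 hz.memLp (t + r)), MemLp.coeFn_toLp (hz.memLp (t + s)),
            MemLp.coeFn_toLp (hz.memLp (t + r))] with ω h1 h2 h3 h4
          rw [h1, h2, toL2, toL2, h3, h4]
          conv_lhs => rw [hexp (z (t + s) ω), hexp (z (t + r) ω)]
          simp only [map_sum, map_smul, sum_inner, inner_sum, real_inner_smul_left,
            real_inner_smul_right]
          rw [Finset.sum_comm]
          refine Finset.sum_congr rfl fun a _ => Finset.sum_congr rfl fun b _ => ?_
          ring
      _ = ∑ a, ∑ b, inner ℝ (A (δ a)) (B (δ b)) * ∫ ω, z (t + s) ω a * z (t + r) ω b ∂P := by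
          rw [integral_finsetSum _ fun a _ => integrable_finsetSum _ fun b _ =>
            (hint a b).const_mul _]
          refine Finset.sum_congr rfl fun a _ => ?_
          rw [integral_finsetSum _ fun b _ => (hint a b).const_mul _]
          exact Finset.sum_congr rfl fun b _ => integral_const_mul _ _
      _ = _ := by
          refine Finset.sum_congr rfl fun a _ => Finset.sum_congr rfl fun b _ => ?_
          rw [covariance_eq_sub (hcoord _ a) (hcoord _ b), hmean, hmean]
          simp
  rw [key, key]
  refine Finset.sum_congr rfl fun a _ => Finset.sum_congr rfl fun b _ => ?_
  have := hz.cov_eq (s - r) (t + s) (0 + s) a b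
  rw [show t + s - (s - r) = t + r by ring, show 0 + s - (s - r) = 0 + r by ring] at this
  rw [this]

/-- The innovations are a fixed finite linear filter of the process. -/
theorem exists_filter_innovation [IsProbabilityMeasure P] (hA : FinitePredictorExactness P z)
    (hmean : ∀ t a, ∫ ω, z t ω a ∂P = 0) :
    ∃ V ∈ filterSpan (toL2 hA.stationary.memLp) (Set.Iic (-1)),
      ∀ t, innovation P z hA.stationary.memLp t = toL2 hA.stationary.memLp t - V t := by
  set hz := hA.stationary.memLp
  obtain ⟨p₀, -, hp₀⟩ := hA.exactness
  have hmem : (pastSpace P z (0 - 1)).starProjection (toL2 hz 0)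
      ∈ closedSpan P z (Set.Icc (0 - (p₀ : ℤ)) (0 - 1)) := by
    have h := hp₀ 0
    rw [toL2, h]
    exact Submodule.starProjection_apply_mem (lagSpace P z p₀ 0) _
  -- The predictor's coefficients are read off at time `0`; `V` applies the same coefficients at
  -- every time.
  obtain ⟨V, hV, hV0⟩ := exists_filterSpan_apply_zero_eq hz (Set.finite_Icc _ _) hmem
  replace hV : V ∈ filterSpan (toL2 hz) (Set.Iic (-1)) :=
    filterSpan_mono (fun s hs => by simpa using hs.2) hV
  refine ⟨V, hV, fun t => ?_⟩
  -- Stationarity carries the orthogonality of the prediction error from time `0` to time `t`, so `V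
  -- t` is the projection there as well.
  have hperp : toL2 hz t - V t ∈ (pastSpace P z (t - 1))ᗮ := by
    rw [pastSpace, mem_orthogonal_closedSpan_iff hz]
    intro s hs A
    have hs' : s - t ∈ Set.Iic (-1 : ℤ) := by simp only [Set.mem_Iic] at *; omega
    have h1 := act_mem_filterSpan (ζ := toL2 hz) hs' A
    have h2 : (toL2 hz - V) ∈ filterSpan (toL2 hz) Set.univ :=
      Submodule.sub_mem _ (self_mem_filterSpan (Set.mem_univ _))
        (filterSpan_mono (Set.subset_univ _) hV)
    have h3 := inner_filterSpan (inner_act_toL2 hA.stationary hmean) h1 h2 t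
    simp only [add_sub_cancel, Pi.sub_apply, zero_add, hV0] at h3
    rw [h3]
    refine (Submodule.sub_starProjection_mem_orthogonal (K := pastSpace P z (0 - 1))
      (toL2 hz 0)) _ ?_
    have h4 := filterSpan_apply_mem_pastSpace hz h1 0
    simpa using h4
  have hmem' : V t ∈ pastSpace P z (t - 1) := filterSpan_apply_mem_pastSpace hz hV t
  rw [innovation]
  congr 1
  exact Submodule.eq_starProjection_of_mem_orthogonal hmem' hperp

theorem innovation_mem_orthogonal (hz : ∀ t, MemLp (z t) 2 P) (t : ℤ) :
    innovation P z hz t ∈ (pastSpace P z (t - 1))ᗮ :=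
  Submodule.sub_starProjection_mem_orthogonal _

/-- A truncated Wold decomposition. -/
theorem toL2_mem_sup_filterSpan (hz : ∀ t, MemLp (z t) 2 P)
    {V : ℤ → Lp (EuclideanSpace ℝ ι) 2 P} (hV : V ∈ filterSpan (toL2 hz) (Set.Iic (-1)))
    (hinn : ∀ t, innovation P z hz t = toL2 hz t - V t) (J : ℕ) :
    toL2 hz ∈ filterSpan (innovation P z hz) (Set.Ioc (-J) 0)
      ⊔ filterSpan (toL2 hz) (Set.Iic (-J)) := by
  induction J with
  | zero => exact Submodule.mem_sup_right (self_mem_filterSpan (by simp))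
  | succ J ih =>
    refine sup_le (a := filterSpan (innovation P z hz) (Set.Ioc (-J) 0)) ?_ ?_ ih
    · exact (filterSpan_mono (Set.Ioc_subset_Ioc_left (by push_cast; linarith))).trans le_sup_left
    · refine Submodule.span_le.mpr ?_
      rintro _ ⟨s, hs, A, rfl⟩
      rcases (Set.mem_Iic.mp hs).lt_or_eq with h | rfl
      · exact Submodule.mem_sup_right (act_mem_filterSpan
          (by simp only [Set.mem_Iic]; push_cast; omega) A)
      -- Only lag `-J` has to be removed: `z` at that lag is its innovation plus `V`, which involves
      -- lags at most `-(J + 1)`.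
      · have h1 : (fun t => act P A (innovation P z hz (t + -J)))
            ∈ filterSpan (innovation P z hz) (Set.Ioc (-(J + 1 : ℕ)) 0) :=
          act_mem_filterSpan (by simp only [Set.mem_Ioc]; push_cast; omega) A
        have h2 : (fun t => act P A (V (t + -J)))
            ∈ filterSpan (toL2 hz) (Set.Iic (-(J + 1 : ℕ))) :=
          act_apply_mem_filterSpan (shift_mem_filterSpan hV
            (by simp only [Set.mem_Iic]; push_cast; intros; omega)) A
        have h3 : (fun t => act P A (toL2 hz (t + -J)))
            = (fun t => act P A (innovation P z hz (t + -J)))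
              + fun t => act P A (V (t + -J)) := by
          ext1 t
          simp [hinn]
        rw [SetLike.mem_coe, h3]
        exact Submodule.add_mem_sup h1 h2

theorem exists_innovation_filter_near [IsProbabilityMeasure P] (hA : FinitePredictorExactness P z)
    (hmean : ∀ t a, ∫ ω, z t ω a ∂P = 0) {η : ℝ} (hη : 0 < η) :
    ∃ Y ∈ filterSpan (innovation P z hA.stationary.memLp) (Set.Iic 0),
      ∀ t, ‖toL2 hA.stationary.memLp t - Y t‖ ≤ η := by
  set hz := hA.stationary.memLp
  obtain ⟨V, hV, hinn⟩ := exists_filter_innovation hA hmean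
  have hlim := tendsto_starProjection_of_iInf_eq_bot (fun n : ℕ => pastSpace P z (0 + -n))
    (fun m n h => closedSpan_mono (Set.Iic_subset_Iic.mpr (by omega)))
    (by
      rw [eq_bot_iff, ← hA.nondeterministic]
      refine le_iInf fun t => (iInf_le _ t.natAbs).trans ?_
      exact closedSpan_mono (Set.Iic_subset_Iic.mpr (by omega))) (toL2 hz 0)
  obtain ⟨J, hJ⟩ := (hlim.norm.eventually (gt_mem_nhds (by simpa using hη))).exists
  obtain ⟨Y, hY, R, hR, hYR⟩ := Submodule.mem_sup.mp (toL2_mem_sup_filterSpan hz hV hinn J)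
  refine ⟨Y, filterSpan_mono Set.Ioc_subset_Iic_self hY, fun t => ?_⟩
  have hRt : ∀ t, toL2 hz t - Y t = R t := fun t => by
    rw [← hYR]; simp
  -- The innovations in `Y 0` have times `s > -J` and are orthogonal to the past up to `s - 1 ≥ -J`.
  have hYperp : Y 0 ∈ (pastSpace P z (0 + -J))ᗮ := by
    clear hYR hRt
    induction hY using Submodule.span_induction with
    | mem Y hY =>
      obtain ⟨s, hs, A, rfl⟩ := hY
      refine act_mem_orthogonal_closedSpan hz ?_ A
      refine Submodule.orthogonal_le ?_ (innovation_mem_orthogonal hz (0 + s))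
      refine closedSpan_mono (Set.Iic_subset_Iic.mpr ?_)
      have := hs.1
      omega
    | zero => exact Submodule.zero_mem _
    | add V W _ _ hV hW => exact Submodule.add_mem _ hV hW
    | smul c V _ hV => exact Submodule.smul_mem _ c hV
  -- Hence the remainder at time `0` is exactly the projection of `z_0` onto the remote past, which
  -- is small for the chosen `J`.
  have hproj : (pastSpace P z (0 + -J)).starProjection (toL2 hz 0) = R 0 :=
    Submodule.eq_starProjection_of_mem_orthogonal (filterSpan_apply_mem_pastSpace hz hR 0) (by
      rw [← hRt]; simpa using hYperp)
  have hnorm : ‖R t‖ = ‖R 0‖ := by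
    rw [norm_eq_sqrt_real_inner, norm_eq_sqrt_real_inner,
      inner_filterSpan (inner_act_toL2 hA.stationary hmean) hR hR t]
  rw [hRt, hnorm, ← hproj]
  exact hJ.le

end Wold

/-! ### Approximability and stationary moments of the regression variables. -/

section LinearProcess

variable {Ω : Type*} [MeasurableSpace Ω] {P : Measure Ω} {ι : Type*} [Fintype ι]
  {z : ℤ → Ω → EuclideanSpace ℝ ι}

/-- Truncation of a process with bounded moments of order larger than `4`. -/
theorem isApprox_coord_of_moment {ε : ℤ → Ω → EuclideanSpace ℝ ι} (hε : ∀ t, Measurable (ε t))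
    {δ : ℝ} (hδ : 0 < δ) {C : ℝ≥0} (hC : ∀ t, ∫⁻ ω, ‖ε t ω‖ₑ ^ (4 + 2 * δ) ∂P ≤ C) (a : ι) :
    IsApprox P ε 2 fun t ω => ε t ω a where
  aesm t := ((EuclideanSpace.proj (𝕜 := ℝ) a).continuous.measurable.comp
    (hε t)).aestronglyMeasurable
  approx η hη := by
    have hcoord : Measurable fun v : EuclideanSpace ℝ ι => v a :=
      (EuclideanSpace.proj (𝕜 := ℝ) a).continuous.measurable
    -- Chosen so that `M ≥ 1` and `C ≤ (η * M) ^ 2`, the two facts used for the truncation error.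
    set M : ℝ≥0 := 1 + (1 + C) / η with hM
    have hM1 : 1 ≤ M := by simp [hM]
    have hCM : C ≤ (η * M) ^ 2 := by
      have : η * M = η + (1 + C) := by rw [hM, mul_add, mul_one, mul_div_cancel₀ _ hη.ne']
      rw [this]
      calc C ≤ 1 + C := by simp
        _ ≤ (1 + C) ^ 2 := le_self_pow₀ (le_add_of_nonneg_right zero_le) two_ne_zero
        _ ≤ (η + (1 + C)) ^ 2 := pow_le_pow_left' le_add_self 2
    let trunc : EuclideanSpace ℝ ι → ℝ := fun v => if |v a| ≤ M then v a else 0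
    have htrunc : Measurable trunc :=
      Measurable.ite (measurableSet_le (measurable_norm.comp hcoord) measurable_const)
        hcoord measurable_const
    refine ⟨0, M, fun t ω => trunc (ε t ω), fun t ω => ?_, fun t => ?_, fun t => ?_⟩
    · simp only [trunc]
      split_ifs with h
      · exact h
      · simp
    · exact htrunc.comp (measurable_sigmaOn (by simp))
    · set f : Ω → ℝ := (fun ω => ε t ω a) - fun ω => trunc (ε t ω) with hf
      -- A Chebyshev bound: where the truncation acts, `M` is below the norm of `ε t`, so two powers
      -- of `M` are absorbed into the fourth power; `M ≥ 1` then allows raising the exponent.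
      have hpt : ∀ ω, ‖f ω‖ₑ ^ (2 : ℝ) * (M : ℝ≥0∞) ^ 2 ≤ ‖ε t ω‖ₑ ^ (4 + 2 * δ) := by
        intro ω
        by_cases h : |ε t ω a| ≤ M
        · have : f ω = 0 := by simp [hf, trunc, h]
          simp [this]
        · have h0 : f ω = ε t ω a := by simp [hf, trunc, h]
          rw [h0]
          have h1 : ‖ε t ω a‖ₑ ≤ ‖ε t ω‖ₑ := by
            rw [enorm_le_iff_norm_le]; exact PiLp.norm_apply_le (ε t ω) a
          have h2 : (M : ℝ≥0∞) ≤ ‖ε t ω a‖ₑ := by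
            rw [enorm_eq_nnnorm, ENNReal.coe_le_coe, ← NNReal.coe_le_coe]
            simpa using (not_le.mp h).le
          have h3 : 1 ≤ ‖ε t ω‖ₑ :=
            le_trans (by exact_mod_cast hM1) (h2.trans h1)
          calc _ ≤ ‖ε t ω‖ₑ ^ (2 : ℝ) * ‖ε t ω‖ₑ ^ 2 := by
                gcongr; exact h2.trans h1
            _ = ‖ε t ω‖ₑ ^ (4 : ℝ) := by
                rw [← ENNReal.rpow_natCast, ← ENNReal.rpow_add_of_nonneg _ _ (by norm_num)
                  (by norm_num)]
                norm_num
            _ ≤ _ := ENNReal.rpow_le_rpow_of_exponent_le h3 (by linarith)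
      have hint : (∫⁻ ω, ‖f ω‖ₑ ^ (2 : ℝ) ∂P) * (M : ℝ≥0∞) ^ 2
          ≤ (η : ℝ≥0∞) ^ 2 * (M : ℝ≥0∞) ^ 2 := by
        rw [← lintegral_mul_const' _ _ (by simp)]
        refine (lintegral_mono hpt).trans ((hC t).trans ?_)
        rw [← mul_pow]
        exact_mod_cast hCM
      have hM0 : (M : ℝ≥0∞) ^ 2 ≠ 0 := by
        have : M ≠ 0 := (zero_lt_one.trans_le hM1).ne'
        simpa using this
      have hint' := (ENNReal.mul_le_mul_iff_left hM0 (by simp)).mp hint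
      rw [eLpNorm_eq_lintegral_rpow_enorm_toReal two_ne_zero ENNReal.ofNat_ne_top]
      simp only [ENNReal.toReal_ofNat]
      rw [one_div, ENNReal.rpow_inv_le_iff two_pos]
      exact_mod_cast hint'

/-- Finite filters of a process inherit approximability. -/
theorem isApprox_of_mem_filterSpan {ε Y : ℤ → Lp (EuclideanSpace ℝ ι) 2 P}
    (hε : ∀ a, IsApprox P (fun t => ⇑(ε t)) 2 fun t ω => ε t ω a)
    (hY : Y ∈ filterSpan ε (Set.Iic 0)) (a : ι) :
    IsApprox P (fun t => ⇑(ε t)) 2 fun t ω => Y t ω a := by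
  classical
  have hm : ∀ t, Measurable (ε t) := fun t => (Lp.stronglyMeasurable (ε t)).measurable
  induction hY using Submodule.span_induction with
  | mem Y hY =>
    obtain ⟨s, hs, A, rfl⟩ := hY
    have h := IsApprox.sum one_le_two hm Finset.univ (V := fun b t ω =>
        A (EuclideanSpace.single b 1) a * ε (t - s.natAbs) ω b)
      fun b _ => ((hε b).shift s.natAbs).const_mul _
    refine h.congr fun t => ?_
    -- The lag is nonpositive, so it is a backward shift by a natural number, as `IsApprox.shift`
    -- requires.
    have hs' : t - (s.natAbs : ℤ) = t + s := by have := Set.mem_Iic.mp hs; omega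
    filter_upwards [coeFn_act A (ε (t + s))] with ω hω
    rw [hω, hs']
    have hexp : ε (t + s) ω = ∑ b, ε (t + s) ω b • EuclideanSpace.single b (1 : ℝ) := by
      simpa using ((EuclideanSpace.basisFun ι ℝ).sum_repr (ε (t + s) ω)).symm
    conv_rhs => rw [hexp]
    simp [map_sum, map_smul, mul_comm]
  | zero =>
    refine (isApprox_const 0).congr fun t => ?_
    filter_upwards [Lp.coeFn_zero (EuclideanSpace ℝ ι) 2 P] with ω hω
    rw [Pi.zero_apply, hω]; rfl
  | add V W _ _ hV hW =>
    refine (hV.add one_le_two hm hW).congr fun t => ?_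
    filter_upwards [Lp.coeFn_add (V t) (W t)] with ω hω
    rw [Pi.add_apply, hω]; rfl
  | smul c V _ hV =>
    refine (hV.const_mul c).congr fun t => ?_
    filter_upwards [Lp.coeFn_smul c (V t)] with ω hω
    rw [Pi.smul_apply, hω]; rfl

/-- A finite filter of innovations is uniformly near `z`, and its inputs are approximable by
truncation; the two errors combine through `IsApprox.of_uniform_limit`. -/
theorem isApprox_coord [IsProbabilityMeasure P] (hA : FinitePredictorExactness P z)
    (hmean : ∀ t a, ∫ ω, z t ω a ∂P = 0) (a : ι) :
    IsApprox P (fun t => ⇑(innovation P z hA.stationary.memLp t)) 2 fun t ω => z t ω a := by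
  set hz := hA.stationary.memLp
  obtain ⟨δ, hδ, -, -, C, hC⟩ := hA.mixing_moments
  have hm : ∀ t, Measurable (innovation P z hz t) := fun t =>
    (Lp.stronglyMeasurable (innovation P z hz t)).measurable
  have hinn := fun a => isApprox_coord_of_moment hm hδ hC a
  have hproj : Continuous fun v : EuclideanSpace ℝ ι => v a :=
    (EuclideanSpace.proj (𝕜 := ℝ) a).continuous
  refine IsApprox.of_uniform_limit one_le_two hm
    (fun t => hproj.comp_aestronglyMeasurable (hz t).1) fun η hη => ?_
  obtain ⟨Y, hY, hYz⟩ := exists_innovation_filter_near hA hmean (NNReal.coe_pos.mpr hη)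
  refine ⟨_, isApprox_of_mem_filterSpan hinn hY a, fun t => ?_⟩
  calc _ ≤ eLpNorm (toL2 hz t - Y t : Lp (EuclideanSpace ℝ ι) 2 P) 2 P := by
        refine eLpNorm_mono_ae ?_
        filter_upwards [MemLp.coeFn_toLp (hz t), Lp.coeFn_sub (toL2 hz t) (Y t)] with ω h1 h2
        rw [h2, Pi.sub_apply, Pi.sub_apply, toL2, h1]
        exact PiLp.norm_apply_le (z t ω - Y t ω) a
    _ = ‖toL2 hz t - Y t‖ₑ := (Lp.enorm_def _).symm
    _ ≤ η := by
        rw [enorm_eq_nnnorm, ENNReal.coe_le_coe, ← NNReal.coe_le_coe]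
        exact hYz t

/-- A real process that is a fixed affine function of the current value of `z`. -/
def IsAffine (z : ℤ → Ω → EuclideanSpace ℝ ι) (f : ℤ → Ω → ℝ) : Prop :=
  ∃ (r : ι → ℝ) (m : ℝ), ∀ t ω, f t ω = ∑ c, r c * z t ω c + m

omit [MeasurableSpace Ω] in
theorem isAffine_const (m : ℝ) : IsAffine z fun _ _ => m := ⟨0, m, by simp⟩

omit [MeasurableSpace Ω] in
theorem isAffine_coord_add (a : ι) (m : ℝ) : IsAffine z fun t ω => z t ω a + m := by
  classical
  exact ⟨Pi.single a 1, m, fun t ω => by simp [Pi.single_apply]⟩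

theorem IsAffine.isApprox [IsProbabilityMeasure P] (hA : FinitePredictorExactness P z)
    (hmean : ∀ t a, ∫ ω, z t ω a ∂P = 0) {f : ℤ → Ω → ℝ} (hf : IsAffine z f) :
    IsApprox P (fun t => ⇑(innovation P z hA.stationary.memLp t)) 2 f := by
  obtain ⟨r, m, h⟩ := hf
  have hm : ∀ t, Measurable (innovation P z hA.stationary.memLp t) := fun t =>
    (Lp.stronglyMeasurable (innovation P z hA.stationary.memLp t)).measurable
  obtain rfl : f = fun t ω => ∑ c, r c * z t ω c + m := by ext t ω; exact h t ω
  exact (IsApprox.sum one_le_two hm _ fun c _ =>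
    (isApprox_coord hA hmean c).const_mul (r c)).add one_le_two hm (isApprox_const m)

theorem IsAffine.memLp [IsProbabilityMeasure P] (hz : IsCovStationary P z) {f : ℤ → Ω → ℝ}
    (hf : IsAffine z f) (t : ℤ) : MemLp (f t) 2 P := by
  obtain ⟨r, m, h⟩ := hf
  have : f t = fun ω => ∑ c, r c * z t ω c + m := by ext ω; exact h t ω
  rw [this]
  exact (memLp_finsetSum _ fun c _ =>
    ((EuclideanSpace.proj (𝕜 := ℝ) c).comp_memLp' (hz.memLp t)).const_mul (r c)).add
    (memLp_const m)

/-- The product moment is a combination of lag-zero covariances plus the product `m * n` of the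
means. It supplies the constant mean required by the law of large numbers, and shows that `Q_Z` and
`E[Z_t u_t]` do not depend on `t`. -/
theorem IsAffine.integral_mul_eq [IsProbabilityMeasure P] (hz : IsCovStationary P z)
    (hmean : ∀ t a, ∫ ω, z t ω a ∂P = 0) {f g : ℤ → Ω → ℝ} (hf : IsAffine z f)
    (hg : IsAffine z g) (s t : ℤ) : ∫ ω, f s ω * g s ω ∂P = ∫ ω, f t ω * g t ω ∂P := by
  have hfL := hf.memLp hz
  have hgL := hg.memLp hz
  obtain ⟨r, m, hf⟩ := hf
  obtain ⟨q, n, hg⟩ := hg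
  have hcoord : ∀ t a, MemLp (fun ω => z t ω a) 2 P := fun t a =>
    (EuclideanSpace.proj (𝕜 := ℝ) a).comp_memLp' (hz.memLp t)
  have hsum : ∀ (r : ι → ℝ) t, Integrable (fun ω => ∑ c, r c * z t ω c) P := fun r t =>
    integrable_finsetSum _ fun c _ => ((hcoord t c).integrable one_le_two).const_mul _
  have hmeanf : ∀ (r : ι → ℝ) (m : ℝ) t, ∫ ω, (∑ c, r c * z t ω c + m) ∂P = m := by
    intro r m t
    rw [integral_add (hsum r t) (integrable_const _),
      integral_finsetSum _ fun c _ => ((hcoord t c).integrable one_le_two).const_mul _]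
    simp [integral_const_mul, hmean]
  have hcov : ∀ t, ∫ ω, f t ω * g t ω ∂P
      = ∑ c, ∑ d, r c * (q d * cov[fun ω => z t ω c, fun ω => z t ω d; P]) + m * n := by
    intro t
    have h := covariance_eq_sub (hfL t) (hgL t)
    have hft : f t = fun ω => ∑ c, r c * z t ω c + m := by ext ω; exact hf t ω
    have hgt : g t = fun ω => ∑ c, q c * z t ω c + n := by ext ω; exact hg t ω
    have e1 : ∫ ω, f t ω ∂P = m := by rw [hft]; exact hmeanf r m t
    have e2 : ∫ ω, g t ω ∂P = n := by rw [hgt]; exact hmeanf q n t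
    have e3 : cov[f t, g t; P]
        = ∑ c, ∑ d, r c * (q d * cov[fun ω => z t ω c, fun ω => z t ω d; P]) := by
      rw [hft, hgt, covariance_add_const_left (hsum r t), covariance_add_const_right (hsum q t),
        covariance_fun_sum_fun_sum (fun c => (hcoord t c).const_mul _)
          (fun c => (hcoord t c).const_mul _)]
      simp only [covariance_const_mul_left, covariance_const_mul_right, mul_left_comm]
    rw [e1, e2, e3] at h
    simp only [Pi.mul_apply] at h
    linarith
  rw [hcov, hcov]
  congr 1
  refine Finset.sum_congr rfl fun c _ => Finset.sum_congr rfl fun d _ => ?_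
  simpa using congrArg (fun y => r c * (q d * y)) (by simpa using hz.cov_eq 0 s t c d)

end LinearProcess

/-! ### Convergence in probability and continuous mapping. -/

section ConvergenceInProbability

variable {Ω : Type*} [MeasurableSpace Ω] {P : Measure Ω} [IsProbabilityMeasure P]

theorem IsApprox.tendstoInMeasure_average {E : Type*} [MeasurableSpace E] {e : ℤ → Ω → E}
    (he : ∀ t, Measurable (e t)) (hmix : Tendsto (mixingCoeff P e) atTop (𝓝 0))
    {W : ℤ → Ω → ℝ} (hW : IsApprox P e 1 W) {c : ℝ} (hc : ∀ t, ∫ ω, W t ω ∂P = c) :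
    TendstoInMeasure P (fun (T : ℕ) ω => (T : ℝ)⁻¹ * ∑ t ∈ Finset.Icc 1 T, W t ω) atTop
      fun _ => c := by
  have hlim := hW.tendsto_integral_abs_average he hmix
  have hWi : ∀ t, Integrable (W t) P := by
    obtain ⟨J, M, b, h1, h2, h3⟩ := hW.approx 1 one_pos
    intro t
    have hbi : Integrable (b t) P :=
      Integrable.of_bound ((h2 t).mono (sigmaOn_le he _) le_rfl).aestronglyMeasurable M
        (ae_of_all _ fun ω => by simpa using h1 t ω)
    have hdi : Integrable (W t - b t) P := memLp_one_iff_integrable.mp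
      ⟨(hW.aesm t).sub hbi.1, (h3 t).trans_lt ENNReal.coe_lt_top⟩
    simpa using hdi.add hbi
  have hSi : ∀ T : ℕ, Integrable (fun ω => (T : ℝ)⁻¹ * ∑ t ∈ Finset.Icc 1 T, W t ω) P := fun T =>
    (integrable_finsetSum (f := fun t : ℕ => W t) _ fun t _ => hWi t).const_mul _
  refine tendstoInMeasure_of_tendsto_eLpNorm one_ne_zero (fun T => (hSi T).1)
    aestronglyMeasurable_const ?_
  have hlim' := ENNReal.tendsto_ofReal hlim
  rw [ENNReal.ofReal_zero] at hlim'
  refine hlim'.congr' ?_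
  -- The average of the constant `c` is `c` only for `T ≥ 1`.
  filter_upwards [eventually_ge_atTop 1] with T hT
  have hT' : (T : ℝ) ≠ 0 := by positivity
  rw [eLpNorm_one_eq_lintegral_enorm,
    ← ofReal_integral_norm_eq_lintegral_enorm ((hSi T).sub (integrable_const c))]
  congr 2
  ext ω
  rw [Real.norm_eq_abs, Pi.sub_apply]
  simp only [hc, Finset.sum_sub_distrib, Finset.sum_const, Nat.card_Icc, nsmul_eq_mul,
    Nat.add_sub_cancel]
  congr 1
  field_simp

omit [IsProbabilityMeasure P] in
theorem tendstoInMeasure_pi {κ : Type*} [Fintype κ] {f : ℕ → Ω → κ → ℝ} {c : κ → ℝ}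
    (h : ∀ k, TendstoInMeasure P (fun n ω => f n ω k) atTop fun _ => c k) :
    TendstoInMeasure P f atTop fun _ => c := by
  rw [tendstoInMeasure_iff_dist]
  intro r hr
  have h0 : Tendsto (fun n => ∑ k, P {ω | r ≤ dist (f n ω k) (c k)}) atTop (𝓝 0) := by
    have := tendsto_finsetSum Finset.univ fun k _ => (tendstoInMeasure_iff_dist.mp (h k)) r hr
    simpa using this
  refine tendsto_of_tendsto_of_tendsto_of_le_of_le tendsto_const_nhds h0 (fun _ => zero_le)
    fun n => ?_
  refine (measure_mono fun ω hω => ?_).trans (measure_iUnion_fintype_le P _)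
  by_contra hcon
  simp only [Set.mem_iUnion, Set.mem_ofPred_eq, not_exists, not_le] at hcon
  exact absurd ((dist_pi_lt_iff hr).mpr hcon) (not_lt.mpr hω)

omit [IsProbabilityMeasure P] in
-- As the limit is constant, continuity at that one point suffices, and monotonicity of the measure
-- makes measurability of `G` irrelevant.
theorem _root_.MeasureTheory.TendstoInMeasure.continuousAt_comp {E F : Type*}
    [PseudoMetricSpace E] [PseudoMetricSpace F] {f : ℕ → Ω → E} {c : E} {G : E → F}
    (h : TendstoInMeasure P f atTop fun _ => c) (hG : ContinuousAt G c) :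
    TendstoInMeasure P (fun n ω => G (f n ω)) atTop fun _ => G c := by
  rw [tendstoInMeasure_iff_dist] at h ⊢
  intro r hr
  obtain ⟨d, hd, hdr⟩ := Metric.continuousAt_iff.mp hG r hr
  refine tendsto_of_tendsto_of_tendsto_of_le_of_le tendsto_const_nhds (h d hd)
    (fun _ => zero_le) fun n => measure_mono fun ω hω => ?_
  by_contra hcon
  exact absurd (hdr (not_le.mp hcon)) (not_lt.mpr hω)

end ConvergenceInProbability

/-! ### The least-squares map and its continuity. -/

section LeastSquares

/-- Sums can thus be replaced by averages. In the singular case both inverses are `0`, so no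
exceptional event has to be removed. -/
theorem inv_smul_mulVec_smul {n : Type*} [Fintype n] [DecidableEq n] {r : ℝ} (hr : r ≠ 0)
    (A : Matrix n n ℝ) (v : n → ℝ) : (r • A)⁻¹ *ᵥ (r • v) = A⁻¹ *ᵥ v := by
  by_cases h : IsUnit A.det
  · have := invertibleOfNonzero hr
    rw [Matrix.inv_smul A r h, Matrix.smul_mulVec, Matrix.mulVec_smul, smul_smul]
    simp
  · have h' : ¬ IsUnit (r • A).det := by
      simpa [Matrix.det_smul, isUnit_iff_ne_zero, hr] using h
    rw [Matrix.nonsing_inv_apply_not_isUnit _ h, Matrix.nonsing_inv_apply_not_isUnit _ h']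
    simp

/-- The least-squares coefficients as a function of the averages of the entries of `Z_t Z_t'` and
`Z_t u_t`. -/
def lsMap {n : Type*} [Fintype n] [DecidableEq n] (κ : n → ℝ) (v : (n × n) ⊕ n → ℝ) : n → ℝ :=
  (Matrix.of fun i j => v (Sum.inl (i, j)))⁻¹ *ᵥ
    ((Matrix.of fun i j => v (Sum.inl (i, j))) *ᵥ κ + fun i => v (Sum.inr i))

/-- The inverse is the adjugate divided by the determinant, which does not vanish at `v`. -/
theorem continuousAt_lsMap {n : Type*} [Fintype n] [DecidableEq n] (κ : n → ℝ)
    {v : (n × n) ⊕ n → ℝ} (hv : (Matrix.of fun i j => v (Sum.inl (i, j))).det ≠ 0) :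
    ContinuousAt (lsMap κ) v := by
  have hA : Continuous fun v : (n × n) ⊕ n → ℝ =>
      (Matrix.of fun i j => v (Sum.inl (i, j)) : Matrix n n ℝ) :=
    continuous_matrix fun i j => continuous_apply _
  have hinv : ContinuousAt (fun v : (n × n) ⊕ n → ℝ =>
      (Matrix.of fun i j => v (Sum.inl (i, j)) : Matrix n n ℝ)⁻¹) v := by
    simp only [Matrix.inv_def, Ring.inverse_eq_inv']
    exact (hA.matrix_det.continuousAt.inv₀ hv).smul hA.matrix_adjugate.continuousAt
  have hvec : Continuous fun v : (n × n) ⊕ n → ℝ =>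
      (Matrix.of fun i j => v (Sum.inl (i, j)) : Matrix n n ℝ) *ᵥ κ + fun i => v (Sum.inr i) :=
    (hA.matrix_mulVec continuous_const).add (continuous_pi fun i => continuous_apply _)
  have hmul : Continuous fun q : Matrix n n ℝ × (n → ℝ) => q.1 *ᵥ q.2 :=
    continuous_fst.matrix_mulVec continuous_snd
  exact hmul.continuousAt.comp (hinv.prodMk hvec.continuousAt)

end LeastSquares

/-! ### Application to the regression system. -/

section Regression

variable {Ω : Type*} [MeasurableSpace Ω] {P : Measure Ω} {N : ℕ} {k : Fin N → ℕ}
  {x : (i : Fin N) → ℤ → Ω → Fin (k i) → ℝ} {u y : ℤ → Ω → Fin N → ℝ}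
  {μx : (i : Fin N) → Fin (k i) → ℝ}

omit [MeasurableSpace Ω] in
theorem isAffine_Z (a : Fin N ⊕ (Σ i, Fin (k i))) (i : Fin N) :
    IsAffine (zbar x u μx) fun t ω => Z x t ω a i := by
  rcases a with j | p
  · exact isAffine_const ((1 : Matrix (Fin N) (Fin N) ℝ) j i)
  · by_cases h : p.1 = i
    · convert isAffine_coord_add (z := zbar x u μx) (Sum.inl p) (μx p.1 p.2) using 3
      simp [Z, X, zbar, h]
    · convert isAffine_const (z := zbar x u μx) 0 using 3
      simp [Z, X, h]

omit [MeasurableSpace Ω] in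
theorem isAffine_u (i : Fin N) : IsAffine (zbar x u μx) fun t ω => u t ω i := by
  convert isAffine_coord_add (z := zbar x u μx) (Sum.inr i) 0 using 3
  simp [zbar]

omit [MeasurableSpace Ω] in
theorem transpose_Z_mulVec_kappa (α : Fin N → ℝ) (β : (i : Fin N) → Fin (k i) → ℝ) (t : ℤ)
    (ω : Ω) (i : Fin N) :
    ((Z x t ω)ᵀ *ᵥ kappa α β) i = α i + ∑ j, x i t ω j * β i j := by
  simp only [Matrix.mulVec, dotProduct, Fintype.sum_sum_type, Matrix.transpose_apply, Z, kappa,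
    Matrix.fromRows_apply_inl, Matrix.fromRows_apply_inr, Sum.elim_inl, Sum.elim_inr, X,
    Matrix.of_apply, Fintype.sum_sigma]
  congr 1
  · simp [Matrix.one_apply]
  · rw [Finset.sum_eq_single i]
    · simp
    · intro b _ hb; simp [hb]
    · simp

theorem EZu_eq (hu : ∀ (t : ℤ) (i : Fin N), ∫ ω, u t ω i ∂P = 0) (t : ℤ) :
    EZu P x u t = Sum.elim (0 : Fin N → ℝ) (EXu P x u t) := by
  ext a
  rcases a with i | p
  · simp [EZu, Z, Matrix.fromRows_mulVec, hu]
  · simp [EZu, EXu, Z, Matrix.fromRows_mulVec]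

theorem integral_zbar [IsProbabilityMeasure P]
    (hL : ∀ t, MemLp (zbar x u μx t) 2 P)
    (hu : ∀ (t : ℤ) (i : Fin N), ∫ ω, u t ω i ∂P = 0)
    (hx : ∀ (t : ℤ) (i : Fin N) (j : Fin (k i)), ∫ ω, x i t ω j ∂P = μx i j) (t : ℤ)
    (a : (Σ i, Fin (k i)) ⊕ Fin N) : ∫ ω, zbar x u μx t ω a ∂P = 0 := by
  have hcoord : Integrable (fun ω => zbar x u μx t ω a) P :=
    ((EuclideanSpace.proj (𝕜 := ℝ) a).comp_memLp' (hL t)).integrable one_le_two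
  rcases a with p | i
  · simp only [zbar, Sum.elim_inl] at hcoord ⊢
    have hxi : Integrable (fun ω => x p.1 t ω p.2) P := by
      refine (hcoord.add (integrable_const (μx p.1 p.2))).congr (ae_of_all _ fun ω => ?_)
      simp
    rw [integral_sub hxi (integrable_const _), hx]
    simp
  · simpa [zbar] using hu t i

/-- The averages of the entries of `Z_t Z_t'` and of `Z_t u_t`. -/
def averages (x : (i : Fin N) → ℤ → Ω → Fin (k i) → ℝ) (u : ℤ → Ω → Fin N → ℝ) (T : ℕ) (ω : Ω) :
    ((Fin N ⊕ (Σ i, Fin (k i))) × (Fin N ⊕ (Σ i, Fin (k i)))) ⊕ (Fin N ⊕ (Σ i, Fin (k i))) → ℝ :=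
  Sum.elim
    (fun a => (T : ℝ)⁻¹ * ∑ t ∈ Finset.Icc 1 T, (Z x (t : ℤ) ω * (Z x (t : ℤ) ω)ᵀ) a.1 a.2)
    (fun a => (T : ℝ)⁻¹ * ∑ t ∈ Finset.Icc 1 T, (Z x (t : ℤ) ω *ᵥ u (t : ℤ) ω) a)

omit [MeasurableSpace Ω] in
-- Substituting the model gives `Z_t y_t = Z_t Z_t' κ + Z_t u_t`. The term in `κ` is not cancelled
-- here, because the sample matrix may be singular.
theorem ols_eq_lsMap (α : Fin N → ℝ) (β : (i : Fin N) → Fin (k i) → ℝ) {T : ℕ} (hT : 1 ≤ T)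
    {ω : Ω} (hy : ∀ t : ℤ, 1 ≤ t → ∀ i, y t ω i = α i + ∑ j, x i t ω j * β i j + u t ω i) :
    ols x y T ω = lsMap (kappa α β) (averages x u T ω) := by
  have hT0 : (T : ℝ)⁻¹ ≠ 0 := by positivity
  have hyv : ∀ t ∈ Finset.Icc 1 T, Z x (t : ℤ) ω *ᵥ y (t : ℤ) ω
      = (Z x (t : ℤ) ω * (Z x (t : ℤ) ω)ᵀ) *ᵥ kappa α β + Z x (t : ℤ) ω *ᵥ u (t : ℤ) ω := by
    intro t ht
    rw [← Matrix.mulVec_mulVec, ← Matrix.mulVec_add]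
    congr 1
    ext i
    rw [Pi.add_apply, transpose_Z_mulVec_kappa]
    exact hy t (by exact_mod_cast (Finset.mem_Icc.mp ht).1) i
  have hA : (Matrix.of fun i j => averages x u T ω (Sum.inl (i, j)))
      = (T : ℝ)⁻¹ • ∑ t ∈ Finset.Icc 1 T, Z x (t : ℤ) ω * (Z x (t : ℤ) ω)ᵀ := by
    ext i j
    simp [averages, Matrix.sum_apply]
  have hc : (fun i => averages x u T ω (Sum.inr i))
      = (T : ℝ)⁻¹ • ∑ t ∈ Finset.Icc 1 T, Z x (t : ℤ) ω *ᵥ u (t : ℤ) ω := by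
    ext i
    simp [averages]
  rw [ols, lsMap, hA, hc, Matrix.smul_mulVec, ← smul_add, inv_smul_mulVec_smul hT0,
    Finset.sum_congr rfl hyv, Finset.sum_add_distrib, Matrix.sum_mulVec]

/-- The probability limit of the least-squares estimator. -/
theorem convergesInProbTo_ols [IsProbabilityMeasure P] (α : Fin N → ℝ)
    (β : (i : Fin N) → Fin (k i) → ℝ)
    (hy : ∀ t : ℤ, 1 ≤ t → ∀ i : Fin N,
      ∀ᵐ ω ∂P, y t ω i = α i + ∑ j, x i t ω j * β i j + u t ω i)
    (hu : ∀ (t : ℤ) (i : Fin N), ∫ ω, u t ω i ∂P = 0)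
    (hx : ∀ (t : ℤ) (i : Fin N) (j : Fin (k i)), ∫ ω, x i t ω j ∂P = μx i j)
    (hA : FinitePredictorExactness P (zbar x u μx)) (t : ℤ) (hQ : (QZ P x t).PosDef) :
    ConvergesInProbTo P (ols x y) (kappa α β + (QZ P x t)⁻¹ *ᵥ EZu P x u t) := by
  have hmean := integral_zbar hA.stationary.memLp hu hx
  have hm : ∀ t, Measurable (innovation P (zbar x u μx) hA.stationary.memLp t) := fun t =>
    (Lp.stronglyMeasurable (innovation P (zbar x u μx) hA.stationary.memLp t)).measurable
  obtain ⟨δ, -, hmix, -⟩ := hA.mixing_moments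
  -- Every entry of `Z_t Z_t'` and of `Z_t u_t` is a finite sum of products of affine functions of
  -- `zbar`, so one law of large numbers serves both.
  have hprod : ∀ (f g : Fin N → ℤ → Ω → ℝ), (∀ i, IsAffine (zbar x u μx) (f i)) →
      (∀ i, IsAffine (zbar x u μx) (g i)) →
      TendstoInMeasure P (fun (T : ℕ) ω => (T : ℝ)⁻¹ * ∑ t ∈ Finset.Icc 1 T,
        ∑ i, f i t ω * g i t ω) atTop fun _ => ∫ ω, ∑ i, f i t ω * g i t ω ∂P := by
    intro f g hf hg
    refine IsApprox.tendstoInMeasure_average (W := fun t ω => ∑ i, f i t ω * g i t ω) hm hmix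
      (IsApprox.sum le_rfl hm _ fun i _ =>
        ((hf i).isApprox hA hmean).mul hm ((hg i).isApprox hA hmean)) fun s => ?_
    have hint : ∀ s i, Integrable (fun ω => f i s ω * g i s ω) P := fun s i =>
      ((hf i).memLp hA.stationary s).integrable_mul ((hg i).memLp hA.stationary s)
    rw [integral_finsetSum _ fun i _ => hint s i, integral_finsetSum _ fun i _ => hint t i]
    exact Finset.sum_congr rfl fun i _ =>
      (hf i).integral_mul_eq hA.stationary hmean (hg i) s t
  have hav : TendstoInMeasure P (averages x u) atTop
      fun _ => Sum.elim (fun a => QZ P x t a.1 a.2) (EZu P x u t) := by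
    refine tendstoInMeasure_pi ?_
    rintro (⟨a, b⟩ | a)
    · have h := hprod (fun i t ω => Z x t ω a i) (fun i t ω => Z x t ω b i) (isAffine_Z a)
        (isAffine_Z b)
      simpa only [averages, QZ, Sum.elim_inl, Matrix.of_apply, Matrix.mul_apply,
        Matrix.transpose_apply] using h
    · have h := hprod (fun i t ω => Z x t ω a i) (fun i t ω => u t ω i) (isAffine_Z a) isAffine_u
      simpa only [averages, EZu, Sum.elim_inr, Matrix.mulVec, dotProduct] using h
  have hdet : (QZ P x t).det ≠ 0 := hQ.det_pos.ne'
  have hlim := hav.continuousAt_comp (continuousAt_lsMap (kappa α β) (v := Sum.elim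
    (fun a => QZ P x t a.1 a.2) (EZu P x u t)) hdet)
  have hval : lsMap (kappa α β) (Sum.elim (fun a => QZ P x t a.1 a.2) (EZu P x u t))
      = kappa α β + (QZ P x t)⁻¹ *ᵥ EZu P x u t := by
    change (QZ P x t)⁻¹ *ᵥ (QZ P x t *ᵥ kappa α β + EZu P x u t) = _
    rw [Matrix.mulVec_add, Matrix.mulVec_mulVec,
      Matrix.nonsing_inv_mul _ (isUnit_iff_ne_zero.mpr hdet), Matrix.one_mulVec]
  rw [hval] at hlim
  refine hlim.congr' ?_ EventuallyEq.rfl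
  -- There are countably many times and equations, so the model holds at all of them off a single
  -- null set.
  have hall : ∀ᵐ ω ∂P, ∀ t : ℤ, 1 ≤ t → ∀ i,
      y t ω i = α i + ∑ j, x i t ω j * β i j + u t ω i :=
    ae_all_iff.mpr fun t => eventually_imp_distrib_left.mpr fun ht => ae_all_iff.mpr fun i => hy t ht i
  filter_upwards [eventually_ge_atTop 1] with T hT
  filter_upwards [hall] with ω hω
  exact (ols_eq_lsMap α β hT hω).symm

end Regression

end SUR

end

theorem proposition3 {Ω : Type*} [MeasurableSpace Ω] (P : Measure Ω) [IsProbabilityMeasure P]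
    {N : ℕ} {k : Fin N → ℕ}
    (x : (i : Fin N) → ℤ → Ω → Fin (k i) → ℝ) (u y : ℤ → Ω → Fin N → ℝ)
    (α : Fin N → ℝ) (β μx : (i : Fin N) → Fin (k i) → ℝ)
    (hy : ∀ t : ℤ, 1 ≤ t → ∀ i : Fin N,
      ∀ᵐ ω ∂P, y t ω i = α i + ∑ j, x i t ω j * β i j + u t ω i)
    (hu : ∀ (t : ℤ) (i : Fin N), ∫ ω, u t ω i ∂P = 0)
    (hx : ∀ (t : ℤ) (i : Fin N) (j : Fin (k i)), ∫ ω, x i t ω j ∂P = μx i j)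
    (hA1 : SUR.FinitePredictorExactness P (SUR.zbar x u μx))
    (t : ℤ) (hA2 : (SUR.QZ P x t).PosDef) :
    (SUR.ConvergesInProbTo P (SUR.ols x y) (SUR.kappa α β) ↔ SUR.EZu P x u t = 0) ∧
    (SUR.ConvergesInProbTo P (SUR.ols x y) (SUR.kappa α β) ↔ SUR.EXu P x u t = 0) ∧
    SUR.ConvergesInProbTo P (SUR.ols x y)
      (SUR.kappa α β + (SUR.QZ P x t)⁻¹ *ᵥ Sum.elim 0 (SUR.EXu P x u t)) := by
  have hlim := SUR.convergesInProbTo_ols α β hy hu hx hA1 t hA2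
  have hEZu := SUR.EZu_eq (x := x) hu t
  have hiff : SUR.ConvergesInProbTo P (SUR.ols x y) (SUR.kappa α β) ↔ SUR.EZu P x u t = 0 := by
    constructor
    · intro h
      -- The two limits are constants that agree almost everywhere; one `ω` suffices to equate them.
      obtain ⟨ω, hω⟩ := (tendstoInMeasure_ae_unique hlim h).exists
      have h0 : (SUR.QZ P x t)⁻¹ *ᵥ SUR.EZu P x u t = 0 := by simpa using hω
      have h1 := congrArg (SUR.QZ P x t *ᵥ ·) h0
      simpa [Matrix.mulVec_mulVec,
        Matrix.mul_nonsing_inv _ (isUnit_iff_ne_zero.mpr hA2.det_pos.ne')] using h1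
    · intro h
      simpa [h] using hlim
  refine ⟨hiff, hiff.trans ?_, hEZu ▸ hlim⟩
  rw [hEZu]
  constructor
  · intro h
    ext p
    simpa using congrFun h (Sum.inr p)
  · intro h
    rw [h]
    ext a
    rcases a <;> rfl
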